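/- Let $(\mathcal X,\nu)$ and $(\mathcal Z,\mu)$ be $\sigma$-finite measure spaces, $T\in\mathbb N$, $N\ge 1$. Let $p$ be a sequential latent variable model $p(x_{1:T},z_{1:T})=\prod_{t=1}^T p_t(x_t,z_t\mid x_{1:t-1},z_{1:t-1})$, where the $p_t$ are measurable, finite-valued conditional densities with respect to $\nu\otimes\mu$. Write $p(x_{1:t})=\int p(x_{1:t},z_{1:t})\,dz_{1:t}$ (all integrals over latents are with respect to $\mu$), and let $p(z_{1:t}\mid x_{1:t})$ and $p(z_{1:t-1}\mid x_{1:t})$ be the corresponding posterior densities. A variational posterior is a product $q(z_{1:T}\mid x_{1:T})=\prod_{t=1}^T q_t(z_t\mid x_{1:t},z_{1:t-1})$ of measurable, finite-valued conditional densities with respect to $\mu$. Given $x_{1:T}$, $p$, $q$ and, for every $t$, a measurable set $C_t$ of weight vectors (the resampling criterion, which may be adaptive), the particle filter starts from $w_0^i=1/N$ $(1\le i\le N)$, $\hat p_N(x_{1:0})=1$, and for $t=1,\dots,T$: it draws $z_t^i\sim q_t(\cdot\mid x_{1:t},z_{1:t-1}^i)$ independently over $i$, puts $z_{1:t}^i=(z_{1:t-1}^i,z_t^i)$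 and $$\alpha_t(z_{1:t}^i)=\frac{p_t(x_t,z_t^i\mid x_{1:t-1},z_{1:t-1}^i)}{q_t(z_t^i\mid x_{1:t},z_{1:t-1}^i)},\qquad \hat p_t=\sum_{i=1}^N w_{t-1}^i\,\alpha_t(z_{1:t}^i),\qquad \hat p_N(x_{1:t})=\hat p_N(x_{1:t-1})\,\hat p_t,\qquad w_t^i=\frac{w_{t-1}^i\,\alpha_t(z_{1:t}^i)}{\hat p_t};$$ and if $(w_t^i)_{i}\in C_t$, it replaces the $N$ trajectories by $N$ independent draws from the categorical distribution on $\{z_{1:t}^i\}_i$ with probabilities $(w_t^i)_i$ and resets all weights to $1/N$. (If $\hat p_t=0$, the estimate is $0$ from then on, all weights are set to $0$ and nothing is resampled.) The filtering variational objective is $\mathrm{FIVO}_N(x_{1:T},p,q)=\mathbb E[\log\hat p_N(x_{1:T})]\in[-\infty,\infty]$. Fix an observation $x_{1:T}$ with $0<p(x_{1:T})<\infty$, and assume that $p(z_{1:t-1}\mid x_{1:t})=p(z_{1:t-1}\mid x_{1:t-1})$ for almost every $z_{1:t-1}$, for every $t\in\{2,\dots,T\}$. Then $q\mapsto\mathrm{FIVO}_N(x_{1:T},p,q)$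 attains its maximum over all variational posteriors; a variational posterior $q^*$ is a maximizer if and only if $$q^*(z_{1:T}\mid x_{1:T})=p(z_{1:T}\mid x_{1:T})\quad\text{for almost every }z_{1:T};$$ and every maximizer $q^*$ satisfies $\mathrm{FIVO}_N(x_{1:T},p,q^*)=\log p(x_{1:T})$. -/

import Mathlib

open MeasureTheory
open scoped ENNReal NNReal

noncomputable section

/-- A sequential latent variable model of horizon `T`, with densities with respect to reference
measures `ν` on the observation space `X` and `μ` on the latent space `Z`. Time is counted from
`0`: `dens t xs zs x z` is the conditional density of the observation-latent pair number `t`, at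
`(x, z)`, given the `t` previous observations `xs` and the `t` previous latents `zs`.
Only the indices `t < T` matter. -/
structure SequentialModel {X Z : Type*} [MeasurableSpace X] [MeasurableSpace Z]
    (ν : Measure X) (μ : Measure Z) (T : ℕ) where
  dens : (t : ℕ) → (Fin t → X) → (Fin t → Z) → X → Z → ℝ≥0
  measurable_dens : ∀ t < T, Measurable
    fun a : (Fin t → X) × (Fin t → Z) × X × Z => dens t a.1 a.2.1 a.2.2.1 a.2.2.2
  lintegral_dens : ∀ t < T, ∀ (xs : Fin t → X) (zs : Fin t → Z),
    ∫⁻ x, ∫⁻ z, (dens t xs zs x z : ℝ≥0∞) ∂μ ∂ν = 1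

/-- A variational posterior of horizon `T`, factored over time: `dens t xs zs z` is the density,
at `z`, of the latent number `t` given the `t + 1` observations `xs` up to and including the
current one and the `t` previous latents `zs`. Only the indices `t < T` matter. -/
structure Proposal (X : Type*) {Z : Type*} [MeasurableSpace X] [MeasurableSpace Z]
    (μ : Measure Z) (T : ℕ) where
  dens : (t : ℕ) → (Fin (t + 1) → X) → (Fin t → Z) → Z → ℝ≥0
  measurable_dens : ∀ t < T, Measurable
    fun a : (Fin (t + 1) → X) × (Fin t → Z) × Z => dens t a.1 a.2.1 a.2.2
  lintegral_dens : ∀ t < T, ∀ (xs : Fin (t + 1) → X) (zs : Fin t → Z),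
    ∫⁻ z, (dens t xs zs z : ℝ≥0∞) ∂μ = 1

section Densities

variable {X Z : Type*} [MeasurableSpace X] [MeasurableSpace Z]
  {ν : Measure X} {μ : Measure Z} {T : ℕ}

/-- The first `t` terms of an observation sequence. -/
def obs (x : ℕ → X) (t : ℕ) : Fin t → X := fun i => x i

/-- The first `s` latents of a latent trajectory of length `t`. -/
def latentPrefix {t : ℕ} (z : Fin t → Z) (s : Fin t) : Fin s → Z :=
  fun i => z (Fin.castLE s.isLt.le i)

/-- The trajectory `z` of length `t` followed by the latent `z'`. -/
def concat {t : ℕ} (z : Fin t → Z) (z' : Z) : Fin (t + 1) → Z :=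
  Fin.snoc (α := fun _ => Z) z z'

/-- The joint density of the first `t` observations and the first `t` latents. -/
def SequentialModel.joint (p : SequentialModel ν μ T) (x : ℕ → X) (t : ℕ)
    (z : Fin t → Z) : ℝ≥0 :=
  ∏ s : Fin t, p.dens s (obs x s) (latentPrefix z s) (x s) (z s)

/-- The marginal likelihood of the first `t` observations. -/
def SequentialModel.evidence (p : SequentialModel ν μ T) (x : ℕ → X) (t : ℕ) : ℝ≥0∞ :=
  ∫⁻ z, (p.joint x t z : ℝ≥0∞) ∂Measure.pi fun _ : Fin t => μ

/-- The posterior density of the first `t` latents given the first `t` observations. -/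
def SequentialModel.posterior (p : SequentialModel ν μ T) (x : ℕ → X) (t : ℕ)
    (z : Fin t → Z) : ℝ≥0∞ :=
  (p.joint x t z : ℝ≥0∞) / p.evidence x t

/-- The posterior density of the first `t` latents given the first `t + 1` observations. -/
def SequentialModel.lookaheadPosterior (p : SequentialModel ν μ T) (x : ℕ → X) (t : ℕ)
    (z : Fin t → Z) : ℝ≥0∞ :=
  (∫⁻ z', (p.joint x (t + 1) (concat z z') : ℝ≥0∞) ∂μ) / p.evidence x (t + 1)

/-- The joint density of the `T` latents under the variational posterior. -/
def Proposal.joint (q : Proposal X μ T) (x : ℕ → X) (z : Fin T → Z) : ℝ≥0 :=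
  ∏ t : Fin T, q.dens t (obs x (t + 1)) (latentPrefix z t) (z t)

/-- The incremental importance weight of a trajectory of length `t + 1`, given as its first `t`
latents `zs` and its last latent `z`. -/
def incrementalWeight (p : SequentialModel ν μ T) (q : Proposal X μ T) (x : ℕ → X) (t : ℕ)
    (zs : Fin t → Z) (z : Z) : ℝ≥0 :=
  p.dens t (obs x t) zs (x t) z / q.dens t (obs x (t + 1)) zs z

end Densities

/-- The state of a particle filter with `N` particles after `t` steps: the current estimate of the
marginal likelihood, the weights and the trajectories. -/
abbrev FilterState (Z : Type*) (N t : ℕ) : Type _ :=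
  ℝ≥0 × (Fin N → ℝ≥0) × (Fin N → Fin t → Z)

/-- The categorical distribution with the given probabilities. -/
def categorical {N : ℕ} (w : Fin N → ℝ≥0) : Measure (Fin N) :=
  ∑ i, (w i : ℝ≥0∞) • Measure.dirac i

section Filter

variable {X Z : Type*} [MeasurableSpace X] [MeasurableSpace Z]
  {ν : Measure X} {μ : Measure Z} {T N : ℕ}

/-- The joint law of the `N` new latents, proposed independently, each from the trajectory of its
particle. -/
def proposalLaw (q : Proposal X μ T) (x : ℕ → X) (t : ℕ) (zs : Fin N → Fin t → Z) :
    Measure (Fin N → Z) :=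
  Measure.pi fun i => μ.withDensity fun z => (q.dens t (obs x (t + 1)) (zs i) z : ℝ≥0∞)

/-- Extends the trajectories by the proposed latents, multiplies the likelihood estimate by the
weighted average of the incremental weights, and updates and normalizes the weights. -/
def reweight (p : SequentialModel ν μ T) (q : Proposal X μ T) (x : ℕ → X) (t : ℕ)
    (s : FilterState Z N t) (z : Fin N → Z) : FilterState Z N (t + 1) :=
  let v : Fin N → ℝ≥0 := fun i => s.2.1 i * incrementalWeight p q x t (s.2.2 i) (z i)
  (s.1 * ∑ i, v i, fun i => v i / ∑ j, v j, fun i => concat (s.2.2 i) (z i))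

open Classical in
/-- If the weights satisfy the resampling criterion `C`, draws `N` ancestors independently in
proportion to the weights, and resets the weights to `1 / N`; otherwise changes nothing.
The weights vanish simultaneously exactly when the current likelihood increment is zero; the
likelihood estimate is then zero and remains so, and nothing is resampled. -/
def resample {t : ℕ} (C : Set (Fin N → ℝ≥0)) (s : FilterState Z N t) :
    Measure (FilterState Z N t) :=
  if s.2.1 ∈ C ∧ ∑ i, s.2.1 i ≠ 0 then
    (Measure.pi fun _ : Fin N => categorical s.2.1).map
      fun a : Fin N → Fin N => (s.1, fun _ => (N : ℝ≥0)⁻¹, fun i => s.2.2 (a i))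
  else Measure.dirac s

/-- The law of the state of the particle filter after `t` steps, where `C t` is the resampling
criterion (a set of weight vectors) in force at step `t`. -/
def filterLaw (C : ℕ → Set (Fin N → ℝ≥0)) (p : SequentialModel ν μ T) (q : Proposal X μ T)
    (x : ℕ → X) : (t : ℕ) → Measure (FilterState Z N t)
  | 0 => Measure.dirac (1, fun _ => (N : ℝ≥0)⁻¹, fun _ => Fin.elim0)
  | t + 1 => (filterLaw C p q x t).bind fun s =>
      (proposalLaw q x t s.2.2).bind fun z => resample (C t) (reweight p q x t s z)

end Filter

/-- The expectation of an extended real random variable, as the expectation of its positive part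
minus that of its negative part. -/
def extendedExpectation {Ω : Type*} [MeasurableSpace Ω] (P : Measure Ω) (f : Ω → EReal) : EReal :=
  ((∫⁻ ω, (f ω).toENNReal ∂P : ℝ≥0∞) : EReal) - ((∫⁻ ω, (-f ω).toENNReal ∂P : ℝ≥0∞) : EReal)

/-- The filtering variational objective: the expected logarithm of the particle filter's estimate
of the marginal likelihood of the first `T` observations. Its value may be `-∞`. -/
def fivo {X Z : Type*} [MeasurableSpace X] [MeasurableSpace Z] {ν : Measure X} {μ : Measure Z}
    {T N : ℕ} (C : ℕ → Set (Fin N → ℝ≥0)) (p : SequentialModel ν μ T) (x : ℕ → X)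
    (q : Proposal X μ T) : EReal :=
  extendedExpectation (filterLaw C p q x T) fun s => ENNReal.log (s.1 : ℝ≥0∞)

/-- The set of variational posteriors that maximize the filtering variational objective. -/
def fivoArgmax {X Z : Type*} [MeasurableSpace X] [MeasurableSpace Z] {ν : Measure X}
    {μ : Measure Z} {T N : ℕ} (C : ℕ → Set (Fin N → ℝ≥0)) (p : SequentialModel ν μ T)
    (x : ℕ → X) : Set (Proposal X μ T) :=
  {q | ∀ q' : Proposal X μ T, fivo C p x q' ≤ fivo C p x q}

end

/-!
The logarithm lies below its tangent at the evidence, and the estimate of the particle filter has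
mean at most the evidence. Hence the objective is at most the logarithm of the evidence, with
equality if and only if the estimate is almost surely equal to the evidence.

The hypothesis on the posteriors says that, on the latents charged by the model, the predictive
density of the observation number `t` is a constant. Therefore the estimate is exact at time `t + 1`
if and only if it is exact at time `t` and, at the particles of nonzero weight, the transition
density of the model is proportional to that of the proposal. Likewise, the joint densities of the
model and the proposal are proportional at time `t + 1` if and only if they are so at time `t` and
the transition densities are proportional at almost every latent charged by the model. The
many-to-one formula, by which the expected weighted sum over the particles is an integral against
the model restricted to the latents that the proposal can reach, identifies the two conditions, and
an induction on `t` concludes.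
-/

section ExpectedLog

theorem log_lt_div_sub_one_add_log {y c : ℝ} (hy : 0 < y) (hc : 0 < c) (hne : y ≠ c) :
    Real.log y < y / c - 1 + Real.log c := by
  have h := Real.log_lt_sub_one_of_pos (div_pos hy hc) (by rwa [ne_eq, div_eq_one_iff_eq hc.ne'])
  rw [Real.log_div hy.ne' hc.ne'] at h
  linarith

theorem log_le_div_sub_one_add_log {y c : ℝ} (hy : 0 < y) (hc : 0 < c) :
    Real.log y ≤ y / c - 1 + Real.log c := by
  rcases eq_or_ne y c with rfl | hne
  · simp [hc.ne']
  · exact (log_lt_div_sub_one_add_log hy hc hne).le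

variable {Ω : Type*} [MeasurableSpace Ω] {P : Measure Ω}

section Real

variable [IsProbabilityMeasure P] {Y : Ω → ℝ} {c : ℝ}

theorem integrable_div_sub_one_add_log (hY : Integrable Y P) (c : ℝ) :
    Integrable (fun ω => Y ω / c - 1 + Real.log c) P :=
  ((hY.div_const c).sub (integrable_const 1)).add (integrable_const _)

theorem integral_div_sub_one_add_log_le (hY : Integrable Y P) (hc : 0 < c)
    (hle : ∫ ω, Y ω ∂P ≤ c) : ∫ ω, (Y ω / c - 1 + Real.log c) ∂P ≤ Real.log c := by
  have hsub : Integrable (fun ω => Y ω / c - 1) P := (hY.div_const c).sub (integrable_const 1)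
  rw [integral_add hsub (integrable_const _),
    integral_sub (hY.div_const c) (integrable_const 1), integral_div]
  simpa using (div_le_one hc).2 hle

theorem integral_log_le_log (hpos : ∀ᵐ ω ∂P, 0 < Y ω) (hY : Integrable Y P)
    (hlog : Integrable (fun ω => Real.log (Y ω)) P) (hc : 0 < c) (hle : ∫ ω, Y ω ∂P ≤ c) :
    ∫ ω, Real.log (Y ω) ∂P ≤ Real.log c :=
  (integral_mono_ae hlog (integrable_div_sub_one_add_log hY c)
    (hpos.mono fun _ hω => log_le_div_sub_one_add_log hω hc)).trans
    (integral_div_sub_one_add_log_le hY hc hle)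

theorem ae_eq_of_log_le_integral_log (hpos : ∀ᵐ ω ∂P, 0 < Y ω) (hY : Integrable Y P)
    (hlog : Integrable (fun ω => Real.log (Y ω)) P) (hc : 0 < c) (hle : ∫ ω, Y ω ∂P ≤ c)
    (hge : Real.log c ≤ ∫ ω, Real.log (Y ω) ∂P) : ∀ᵐ ω ∂P, Y ω = c := by
  have htangent := integrable_div_sub_one_add_log hY c
  have hmono := hpos.mono fun _ hω => log_le_div_sub_one_add_log hω hc
  have heq := (integral_eq_iff_of_ae_le hlog htangent hmono).1
    ((integral_mono_ae hlog htangent hmono).antisymm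
      ((integral_div_sub_one_add_log_le hY hc hle).trans hge))
  filter_upwards [hpos, heq] with ω hω h
  by_contra hne
  exact (log_lt_div_sub_one_add_log hω hc hne).ne h

end Real

theorem extendedExpectation_congr_ae {f g : Ω → EReal} (h : f =ᵐ[P] g) :
    extendedExpectation P f = extendedExpectation P g := by
  unfold extendedExpectation
  congr 2 <;> exact lintegral_congr_ae (h.mono fun ω hω => by simp only [hω])

theorem extendedExpectation_const [IsProbabilityMeasure P] (a : EReal) :
    extendedExpectation P (fun _ => a) = a := by
  simp only [extendedExpectation, lintegral_const, measure_univ, mul_one,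
    EReal.coe_toENNReal_eq_max]
  rcases le_total 0 a with h | h
  · rw [max_eq_right h, max_eq_left (by simpa using h), sub_zero]
  · rw [max_eq_left h, max_eq_right (by simpa using h), zero_sub, neg_neg]

theorem extendedExpectation_coe {f : Ω → ℝ} (hf : Integrable f P) :
    extendedExpectation P (fun ω => (f ω : EReal)) = ((∫ ω, f ω ∂P : ℝ) : EReal) := by
  have hpos := hf.lintegral_lt_top.ne
  have hneg : ∫⁻ ω, ENNReal.ofReal (-f ω) ∂P ≠ ∞ := hf.neg.lintegral_lt_top.ne
  simp only [extendedExpectation, ← EReal.coe_neg, EReal.real_coe_toENNReal]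
  rw [integral_eq_lintegral_pos_part_sub_lintegral_neg_part hf, EReal.coe_sub,
    EReal.coe_ennreal_toReal hpos, EReal.coe_ennreal_toReal hneg]

theorem enorm_toReal_le (a : EReal) : ‖a.toReal‖ₑ ≤ a.toENNReal + (-a).toENNReal := by
  induction a with
  | bot => simp
  | top => simp
  | coe r =>
    rw [← EReal.coe_neg, EReal.real_coe_toENNReal, EReal.real_coe_toENNReal, EReal.toReal_coe,
      Real.enorm_eq_ofReal_abs]
    rcases abs_cases r with ⟨h, -⟩ | ⟨h, -⟩ <;> rw [h]
    exacts [le_self_add, le_add_self]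

theorem extendedExpectation_eq_bot_or {f : Ω → EReal} (hf : Measurable f)
    (hpos : ∫⁻ ω, (f ω).toENNReal ∂P ≠ ∞) :
    extendedExpectation P f = ⊥ ∨
      ∃ g : Ω → ℝ, Integrable g P ∧ f =ᵐ[P] fun ω => (g ω : EReal) := by
  by_cases hneg : ∫⁻ ω, (-f ω).toENNReal ∂P = ∞
  · left
    lift ∫⁻ ω, (f ω).toENNReal ∂P to ℝ≥0 using hpos with a ha
    rw [extendedExpectation, hneg, ← ha]
    exact EReal.sub_top _
  · refine .inr ⟨fun ω => (f ω).toReal, ⟨hf.ereal_toReal.aestronglyMeasurable, ?_⟩, ?_⟩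
    · refine (lintegral_mono fun ω => enorm_toReal_le (f ω)).trans_lt ?_
      rw [lintegral_add_left (by fun_prop)]
      exact ENNReal.add_lt_top.2 ⟨hpos.lt_top, Ne.lt_top hneg⟩
    · filter_upwards [ae_lt_top (by fun_prop) hpos, ae_lt_top (by fun_prop) hneg] with ω h h'
      refine (EReal.coe_toReal ?_ ?_).symm <;> rintro heq <;> simp [heq] at h h'

theorem toENNReal_log_le (y : ℝ≥0) : (ENNReal.log y).toENNReal ≤ y := by
  rcases eq_or_ne y 0 with rfl | hy
  · simp
  · rw [ENNReal.log_of_nnreal hy, EReal.real_coe_toENNReal, ← ENNReal.ofReal_coe_nnreal]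
    exact ENNReal.ofReal_le_ofReal (Real.log_le_self y.2)

theorem extendedExpectation_log_eq_bot_or {Y : Ω → ℝ≥0} (hY : Measurable Y)
    (hfin : ∫⁻ ω, (Y ω : ℝ≥0∞) ∂P ≠ ∞) :
    extendedExpectation P (fun ω => ENNReal.log (Y ω)) = ⊥ ∨
      (∀ᵐ ω ∂P, 0 < (Y ω : ℝ)) ∧ Integrable (fun ω => Real.log (Y ω)) P ∧
        extendedExpectation P (fun ω => ENNReal.log (Y ω))
          = ((∫ ω, Real.log (Y ω) ∂P : ℝ) : EReal) := by
  refine (extendedExpectation_eq_bot_or (by fun_prop)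
    (ne_top_of_le_ne_top hfin (lintegral_mono fun ω => toENNReal_log_le (Y ω)))).imp_right ?_
  rintro ⟨g, hg, hlog⟩
  have hne : ∀ᵐ ω ∂P, Y ω ≠ 0 := hlog.mono fun ω h h0 => by simp [h0] at h
  have hloge : (fun ω => ENNReal.log (Y ω)) =ᵐ[P] fun ω => (Real.log (Y ω) : EReal) :=
    hne.mono fun ω h => ENNReal.log_of_nnreal h
  have hint : Integrable (fun ω => Real.log (Y ω)) P := hg.congr <| by
    filter_upwards [hlog, hloge] with ω h h'
    exact EReal.coe_eq_coe_iff.1 (h.symm.trans h')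
  refine ⟨hne.mono fun ω h => by positivity, hint, ?_⟩
  rw [extendedExpectation_congr_ae hloge, extendedExpectation_coe hint]

theorem integrable_coe_of_lintegral_coe_ne_top {Y : Ω → ℝ≥0} (hY : Measurable Y)
    (hfin : ∫⁻ ω, (Y ω : ℝ≥0∞) ∂P ≠ ∞) : Integrable (fun ω => (Y ω : ℝ)) P :=
  ⟨hY.coe_nnreal_real.aestronglyMeasurable, by simpa [HasFiniteIntegral] using hfin.lt_top⟩

variable [IsProbabilityMeasure P] {Y : Ω → ℝ≥0} {c : ℝ≥0}

theorem extendedExpectation_log_le (hY : Measurable Y) (hc : c ≠ 0)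
    (hle : ∫⁻ ω, (Y ω : ℝ≥0∞) ∂P ≤ c) :
    extendedExpectation P (fun ω => ENNReal.log (Y ω)) ≤ ENNReal.log c := by
  have hfin := ne_top_of_le_ne_top ENNReal.coe_ne_top hle
  obtain hbot | ⟨hpos, hlog, hexp⟩ := extendedExpectation_log_eq_bot_or hY hfin
  · exact hbot ▸ bot_le
  · rw [hexp, ENNReal.log_of_nnreal hc, EReal.coe_le_coe_iff]
    exact integral_log_le_log hpos (integrable_coe_of_lintegral_coe_ne_top hY hfin) hlog
      (by positivity) (integral_coe_le_of_lintegral_coe_le hle)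

theorem extendedExpectation_log_eq_iff (hY : Measurable Y) (hc : c ≠ 0)
    (hle : ∫⁻ ω, (Y ω : ℝ≥0∞) ∂P ≤ c) :
    extendedExpectation P (fun ω => ENNReal.log (Y ω)) = ENNReal.log c ↔ ∀ᵐ ω ∂P, Y ω = c := by
  have hfin := ne_top_of_le_ne_top ENNReal.coe_ne_top hle
  refine ⟨fun h => ?_, fun h => ?_⟩
  · obtain hbot | ⟨hpos, hlog, hexp⟩ := extendedExpectation_log_eq_bot_or hY hfin
    · rw [hbot, eq_comm, ENNReal.log_eq_bot_iff, ENNReal.coe_eq_zero] at h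
      exact absurd h hc
    · rw [hexp, ENNReal.log_of_nnreal hc, EReal.coe_eq_coe_iff] at h
      filter_upwards [ae_eq_of_log_le_integral_log hpos
        (integrable_coe_of_lintegral_coe_ne_top hY hfin) hlog (by positivity)
        (integral_coe_le_of_lintegral_coe_le hle) h.ge] with ω hω
      exact_mod_cast hω
  · rw [extendedExpectation_congr_ae (g := fun _ => ENNReal.log c)
      (h.mono fun ω hω => by simp only [hω]), extendedExpectation_const]

end ExpectedLog

section IndependentSum

variable {n : ℕ} {E : Fin n → Type*} [∀ i, MeasurableSpace (E i)]

theorem ae_eq_const_of_ae_sum_eq_const {M : Type*} [AddCancelCommMonoid M]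
    (P : (i : Fin n) → Measure (E i)) [∀ i, IsProbabilityMeasure (P i)] {f : (i : Fin n) → E i → M}
    {c : M} (h : ∀ᵐ z ∂Measure.pi P, ∑ i, f i (z i) = c) (i : Fin n) :
    ∃ k, ∀ᵐ z ∂P i, f i z = k := by
  cases n with
  | zero => exact i.elim0
  | succ n =>
    have hsplit := Measure.ae_ae_of_ae_prod
      ((measurePreserving_piFinSuccAbove P i).symm.quasiMeasurePreserving.ae h)
    simp only [Fin.sum_univ_succAbove _ i, MeasurableEquiv.piFinSuccAbove_symm_apply,
      Fin.insertNthEquiv_apply, Fin.insertNth_apply_same, Fin.insertNth_apply_succAbove] at hsplit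
    obtain ⟨z₀, hz₀⟩ := hsplit.exists
    refine ⟨f i z₀, hsplit.mono fun z hz => ?_⟩
    obtain ⟨y, hy, hy₀⟩ := (hz.and hz₀).exists
    exact add_right_cancel (hy.trans hy₀.symm)

variable (P : (i : Fin n) → Measure (E i)) [∀ i, IsProbabilityMeasure (P i)]

theorem ae_pi_apply {i : Fin n} {A : E i → Prop} (h : ∀ᵐ z ∂P i, A z) :
    ∀ᵐ z ∂Measure.pi P, A (z i) :=
  (measurePreserving_eval P i).quasiMeasurePreserving.ae h

theorem lintegral_pi_sum_mul {w : Fin n → ℝ≥0∞} {f : (i : Fin n) → E i → ℝ≥0∞}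
    (hf : ∀ i, Measurable (f i)) :
    ∫⁻ z, ∑ i, w i * f i (z i) ∂Measure.pi P = ∑ i, w i * ∫⁻ z, f i z ∂P i := by
  have hfi (i : Fin n) : Measurable fun z : (j : Fin n) → E j => f i (z i) :=
    (hf i).comp (measurable_pi_apply i)
  rw [lintegral_finsetSum _ fun i _ => (hfi i).const_mul _]
  refine Finset.sum_congr rfl fun i _ => ?_
  rw [lintegral_const_mul _ (hfi i), (measurePreserving_eval P i).lintegral_comp (hf i)]

theorem ae_sum_mul_eq_of_forall {w : Fin n → ℝ≥0} (hw : ∑ i, w i = 1)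
    {f : (i : Fin n) → E i → ℝ≥0} {c : ℝ≥0} (h : ∀ i, w i ≠ 0 → ∀ᵐ z ∂P i, f i z = c) :
    ∀ᵐ z ∂Measure.pi P, ∑ i, w i * f i (z i) = c := by
  have hall : ∀ᵐ z ∂Measure.pi P, ∀ i, w i ≠ 0 → f i (z i) = c :=
    ae_all_iff.2 fun i => Filter.eventually_imp_distrib_left.2 fun hi => ae_pi_apply P (h i hi)
  filter_upwards [hall] with z hz
  rw [Finset.sum_congr rfl fun i _ => show w i * f i (z i) = w i * c from ?_, ← Finset.sum_mul,
    hw, one_mul]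
  rcases eq_or_ne (w i) 0 with hi | hi
  · simp [hi]
  · rw [hz i hi]

theorem ae_sum_mul_eq_iff {w : Fin n → ℝ≥0} (hw : ∑ i, w i = 1) {f : (i : Fin n) → E i → ℝ≥0}
    (hf : ∀ i, Measurable (f i)) {c : ℝ≥0}
    (hmean : ∀ i, w i ≠ 0 → ∫⁻ z, (f i z : ℝ≥0∞) ∂P i ≤ c) :
    (∀ᵐ z ∂Measure.pi P, ∑ i, w i * f i (z i) = c) ↔
      ∀ i, w i ≠ 0 → ∀ᵐ z ∂P i, f i z = c := by
  constructor
  · intro h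
    choose k hk using ae_eq_const_of_ae_sum_eq_const P (f := fun i z => w i * f i z) h
    have hkle (i : Fin n) : k i ≤ w i * c := by
      rcases eq_or_ne (w i) 0 with hi | hi
      · obtain ⟨z, hz⟩ := (hk i).exists
        simp [← hz, hi]
      have hint : (k i : ℝ≥0∞) = w i * ∫⁻ z, (f i z : ℝ≥0∞) ∂P i := by
        rw [← lintegral_const_mul _ (hf i).coe_nnreal_ennreal,
          lintegral_congr_ae (g := fun _ => (k i : ℝ≥0∞))
          ((hk i).mono fun z hz => by simp only [← hz, ENNReal.coe_mul])]
        simp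
      have hle : (k i : ℝ≥0∞) ≤ w i * c := hint ▸ by gcongr; exact hmean i hi
      exact_mod_cast hle
    have hsum : ∑ i, k i = ∑ i, w i * c := by
      obtain ⟨z, hz, hz'⟩ := (h.and (ae_all_iff.2 fun i => ae_pi_apply P (hk i))).exists
      rw [← Finset.sum_mul, hw, one_mul, ← hz]
      exact Finset.sum_congr rfl fun i _ => (hz' i).symm
    intro i hi
    have hki := (Finset.sum_eq_sum_iff_of_le fun i _ => hkle i).1 hsum i (Finset.mem_univ i)
    exact (hk i).mono fun z hz => mul_left_cancel₀ hi (hz.trans hki)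
  · exact ae_sum_mul_eq_of_forall P hw

end IndependentSum

section Density

variable {Z : Type*} [MeasurableSpace Z] {μ : Measure Z} {f g : Z → ℝ≥0} {c : ℝ≥0}

theorem ae_div_eq_const_iff (hf : Measurable f) (hg : Measurable g)
    (hgint : ∫⁻ z, (g z : ℝ≥0∞) ∂μ = 1) (hfint : ∫⁻ z, (f z : ℝ≥0∞) ∂μ = c) :
    (∀ᵐ z ∂μ, g z ≠ 0 → f z / g z = c) ↔ ∀ᵐ z ∂μ, f z = c * g z := by
  refine ⟨fun h => ?_, fun h => h.mono fun z hz hgz => by rw [hz, mul_div_cancel_right₀ _ hgz]⟩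
  have hle : ∀ᵐ z ∂μ, (c * g z : ℝ≥0∞) ≤ f z := by
    filter_upwards [h] with z hz
    rcases eq_or_ne (g z) 0 with hgz | hgz
    · simp [hgz]
    · exact_mod_cast ((div_eq_iff hgz).1 (hz hgz)).ge
  have hint : ∫⁻ z, (c * g z : ℝ≥0∞) ∂μ = c := by
    rw [lintegral_const_mul _ hg.coe_nnreal_ennreal, hgint, mul_one]
  filter_upwards [ae_eq_of_ae_le_of_lintegral_le hle (hint.trans_ne ENNReal.coe_ne_top)
    hf.coe_nnreal_ennreal.aemeasurable (hfint.trans hint.symm).le] with z hz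
  exact_mod_cast hz.symm

theorem ae_mul_eq_mul_iff (hf : Measurable f) (hg : Measurable g)
    (hgint : ∫⁻ z, (g z : ℝ≥0∞) ∂μ = 1) (hc : c ≠ 0) {a b : ℝ≥0}
    (hfint : a ≠ 0 → ∫⁻ z, (f z : ℝ≥0∞) ∂μ = c) :
    (∀ᵐ z ∂μ, a * f z = c * b * g z) ↔ a = b ∧ (a ≠ 0 → ∀ᵐ z ∂μ, f z = c * g z) := by
  constructor
  · intro h
    have hab : a = b := by
      have hint : ∫⁻ z, (a * f z : ℝ≥0∞) ∂μ = ∫⁻ z, (c * b * g z : ℝ≥0∞) ∂μ :=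
        lintegral_congr_ae (h.mono fun z hz => by
          simpa only [ENNReal.coe_mul] using congrArg ENNReal.ofNNReal hz)
      rw [lintegral_const_mul _ hf.coe_nnreal_ennreal, lintegral_const_mul _ hg.coe_nnreal_ennreal,
        hgint, mul_one, mul_comm (c : ℝ≥0∞)] at hint
      rcases eq_or_ne a 0 with ha | ha
      · simpa [ha, hc, eq_comm] using hint
      · rw [hfint ha] at hint
        exact mul_right_cancel₀ hc (by exact_mod_cast hint)
    refine ⟨hab, fun ha => h.mono fun z hz => mul_left_cancel₀ ha ?_⟩
    rw [hz, hab]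
    ring
  · rintro ⟨rfl, h⟩
    rcases eq_or_ne a 0 with rfl | ha
    · simp
    · exact (h ha).mono fun z hz => by rw [hz]; ring

end Density

section Chain

variable {Z : Type*}

theorem concat_castSucc {t : ℕ} (z : Fin t → Z) (z' : Z) (i : Fin t) :
    concat z z' i.castSucc = z i :=
  Fin.snoc_castSucc (α := fun _ => Z) z' z i

theorem concat_last {t : ℕ} (z : Fin t → Z) (z' : Z) : concat z z' (Fin.last t) = z' :=
  Fin.snoc_last (α := fun _ => Z) z' z

theorem latentPrefix_concat_last {t : ℕ} (z : Fin t → Z) (z' : Z) :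
    latentPrefix (concat z z') (Fin.last t) = z :=
  funext fun i => concat_castSucc z z' i

theorem latentPrefix_concat_castSucc {t : ℕ} (z : Fin t → Z) (z' : Z) (s : Fin t) :
    latentPrefix (concat z z') s.castSucc = latentPrefix z s :=
  funext fun i => concat_castSucc z z' (Fin.castLE s.isLt.le i)

/-- The joint density of the first `t` terms of a sequence with conditional densities `d`. Both
`SequentialModel.joint` and `Proposal.joint` are of this form. -/
def chainDensity (d : (t : ℕ) → (Fin t → Z) → Z → ℝ≥0) (t : ℕ) (z : Fin t → Z) : ℝ≥0 :=
  ∏ s : Fin t, d s (latentPrefix z s) (z s)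

theorem chainDensity_zero (d : (t : ℕ) → (Fin t → Z) → Z → ℝ≥0) (z : Fin 0 → Z) :
    chainDensity d 0 z = 1 :=
  Fin.prod_univ_zero _

theorem chainDensity_concat (d : (t : ℕ) → (Fin t → Z) → Z → ℝ≥0) {t : ℕ} (z : Fin t → Z)
    (z' : Z) : chainDensity d (t + 1) (concat z z') = chainDensity d t z * d t z z' := by
  rw [chainDensity, Fin.prod_univ_castSucc, latentPrefix_concat_last, concat_last]
  simp only [latentPrefix_concat_castSucc, concat_castSucc]
  rfl

variable [MeasurableSpace Z]

theorem measurable_concat {t : ℕ} : Measurable fun a : (Fin t → Z) × Z => concat a.1 a.2 := by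
  refine measurable_pi_lambda _ fun i => ?_
  refine Fin.lastCases ?_ (fun j => ?_) i
  · simpa only [concat_last] using measurable_snd
  · simpa only [concat_castSucc] using measurable_fst.eval

theorem measurable_latentPrefix {t : ℕ} (s : Fin t) :
    Measurable fun z : Fin t → Z => latentPrefix z s :=
  measurable_pi_lambda _ fun _ => measurable_pi_apply _

theorem measurable_chainDensity {d : (t : ℕ) → (Fin t → Z) → Z → ℝ≥0} {t : ℕ}
    (hd : ∀ s < t, Measurable fun a : (Fin s → Z) × Z => d s a.1 a.2) :
    Measurable (chainDensity d t) :=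
  Finset.measurable_fun_prod _ fun s _ =>
    (hd s s.isLt).comp ((measurable_latentPrefix s).prodMk (measurable_pi_apply s))

theorem lintegral_pi_fin_zero (μ : Measure Z) (f : (Fin 0 → Z) → ℝ≥0∞) :
    ∫⁻ z, f z ∂(Measure.pi fun _ : Fin 0 => μ) = f Fin.elim0 := by
  rw [Measure.pi_of_empty (fun _ : Fin 0 => μ) Fin.elim0, lintegral_dirac]

theorem measurableSet_setOf_ae (μ : Measure Z) [SFinite μ] {A : Type*} [MeasurableSpace A]
    {S : Set (A × Z)} (hS : MeasurableSet S) : MeasurableSet {a | ∀ᵐ z ∂μ, (a, z) ∈ S} :=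
  measurable_measure_prodMk_left (ν := μ) hS.compl (measurableSet_singleton 0)

variable (μ : Measure Z) [SigmaFinite μ]

theorem measurePreserving_concat (t : ℕ) :
    MeasurePreserving (fun a : (Fin t → Z) × Z => concat a.1 a.2)
      ((Measure.pi fun _ : Fin t => μ).prod μ) (Measure.pi fun _ : Fin (t + 1) => μ) := by
  convert (measurePreserving_piFinSuccAbove (fun _ : Fin (t + 1) => μ) (Fin.last t)).symm.comp
    (Measure.measurePreserving_swap (μ := Measure.pi fun _ : Fin t => μ) (ν := μ)) using 1
  ext a : 1
  exact (Fin.insertNth_last' (β := Z) a.2 a.1).symm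

theorem lintegral_pi_fin_succ {t : ℕ} {f : (Fin (t + 1) → Z) → ℝ≥0∞} (hf : Measurable f) :
    ∫⁻ z, f z ∂(Measure.pi fun _ : Fin (t + 1) => μ)
      = ∫⁻ z, ∫⁻ z', f (concat z z') ∂μ ∂(Measure.pi fun _ : Fin t => μ) := by
  rw [← (measurePreserving_concat μ t).lintegral_comp hf,
    lintegral_prod (fun a => f (concat a.1 a.2)) (hf.comp measurable_concat).aemeasurable]

theorem ae_pi_fin_succ_iff {t : ℕ} {A : (Fin (t + 1) → Z) → Prop} (hA : MeasurableSet {z | A z}) :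
    (∀ᵐ z ∂(Measure.pi fun _ : Fin (t + 1) => μ), A z) ↔
      ∀ᵐ z ∂(Measure.pi fun _ : Fin t => μ), ∀ᵐ z' ∂μ, A (concat z z') := by
  rw [← (measurePreserving_concat μ t).map_eq, ae_map_iff measurable_concat.aemeasurable hA,
    Measure.ae_prod_iff_ae_ae (p := fun a => A (concat a.1 a.2)) (measurable_concat hA)]

end Chain

noncomputable section Transition

variable {X Z : Type*} [MeasurableSpace X] [MeasurableSpace Z]
  {ν : Measure X} {μ : Measure Z} {T t : ℕ}

/-- The density of the next observation-latent pair of a model, at the next term of the observation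
sequence `x`, as a function of the previous latents and the next one. -/
def SequentialModel.transition (p : SequentialModel ν μ T) (x : ℕ → X) (t : ℕ)
    (zs : Fin t → Z) (z : Z) : ℝ≥0 :=
  p.dens t (obs x t) zs (x t) z

/-- The predictive density of the next term of the observation sequence `x`, given the previous
latents. -/
def SequentialModel.predictive (p : SequentialModel ν μ T) (x : ℕ → X) (t : ℕ)
    (zs : Fin t → Z) : ℝ≥0∞ :=
  ∫⁻ z, (p.transition x t zs z : ℝ≥0∞) ∂μ

/-- The density of the next latent under a variational posterior, along the observation
sequence `x`. -/
def Proposal.transition (q : Proposal X μ T) (x : ℕ → X) (t : ℕ) (zs : Fin t → Z) (z : Z) : ℝ≥0 :=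
  q.dens t (obs x (t + 1)) zs z

/-- The law of the next latent under a variational posterior, given the previous latents. -/
def Proposal.transitionLaw (q : Proposal X μ T) (x : ℕ → X) (t : ℕ) (zs : Fin t → Z) :
    Measure Z :=
  μ.withDensity fun z => (q.transition x t zs z : ℝ≥0∞)

/-- The transition density of the model, cut off to zero where the proposal density vanishes: the
part of the model that the particles can reach. -/
def reachableTransition (p : SequentialModel ν μ T) (q : Proposal X μ T) (x : ℕ → X) (t : ℕ)
    (zs : Fin t → Z) (z : Z) : ℝ≥0 :=
  q.transition x t zs z * incrementalWeight p q x t zs z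

/-- The trajectories from which the next incremental weight is `c` for almost every proposed latent
and from which the proposal covers the model: the transition density of the model is `c` times that
of the proposal. -/
def matchSet (p : SequentialModel ν μ T) (q : Proposal X μ T) (x : ℕ → X) (t : ℕ) (c : ℝ≥0) :
    Set (Fin t → Z) :=
  {zs | ∀ᵐ z ∂μ, p.transition x t zs z = c * q.transition x t zs z}

section Model

variable (p : SequentialModel ν μ T) (x : ℕ → X)

theorem SequentialModel.joint_eq_chainDensity (t : ℕ) :
    p.joint x t = chainDensity (p.transition x) t := rfl

theorem SequentialModel.joint_concat (zs : Fin t → Z) (z : Z) :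
    p.joint x (t + 1) (concat zs z) = p.joint x t zs * p.transition x t zs z :=
  chainDensity_concat (p.transition x) zs z

theorem SequentialModel.measurable_transition (ht : t < T) :
    Measurable fun a : (Fin t → Z) × Z => p.transition x t a.1 a.2 :=
  (p.measurable_dens t ht).comp (f := fun a : (Fin t → Z) × Z => (obs x t, a.1, x t, a.2))
    (by fun_prop)

theorem SequentialModel.measurable_joint (ht : t ≤ T) : Measurable (p.joint x t) :=
  measurable_chainDensity fun _ hs => p.measurable_transition x (hs.trans_le ht)

theorem SequentialModel.measurable_predictive [SFinite μ] (ht : t < T) :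
    Measurable (p.predictive x t) :=
  (p.measurable_transition x ht).coe_nnreal_ennreal.lintegral_prod_right'

end Model

section Proposal

variable (q : Proposal X μ T) (x : ℕ → X)

theorem Proposal.joint_eq_chainDensity : q.joint x = chainDensity (q.transition x) T := rfl

theorem Proposal.measurable_transition (ht : t < T) :
    Measurable fun a : (Fin t → Z) × Z => q.transition x t a.1 a.2 :=
  (q.measurable_dens t ht).comp (f := fun a : (Fin t → Z) × Z => (obs x (t + 1), a.1, a.2))
    (by fun_prop)

theorem Proposal.measurable_chainDensity_transition (ht : t ≤ T) :
    Measurable (chainDensity (q.transition x) t) :=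
  measurable_chainDensity fun _ hs => q.measurable_transition x (hs.trans_le ht)

theorem Proposal.isProbabilityMeasure_transitionLaw (ht : t < T) (zs : Fin t → Z) :
    IsProbabilityMeasure (q.transitionLaw x t zs) :=
  ⟨by
    rw [Proposal.transitionLaw, withDensity_apply _ .univ, Measure.restrict_univ]
    exact q.lintegral_dens t ht _ zs⟩

variable {N : ℕ}

theorem proposalLaw_eq_pi (zs : Fin N → Fin t → Z) :
    proposalLaw q x t zs = Measure.pi fun i => q.transitionLaw x t (zs i) := rfl

theorem isProbabilityMeasure_proposalLaw (ht : t < T) (zs : Fin N → Fin t → Z) :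
    IsProbabilityMeasure (proposalLaw q x t zs) := by
  have := fun i => q.isProbabilityMeasure_transitionLaw x ht (zs i)
  rw [proposalLaw_eq_pi]
  infer_instance

theorem Proposal.measurable_transitionLaw [SFinite μ] (ht : t < T) :
    Measurable (q.transitionLaw x t) := by
  refine Measure.measurable_of_measurable_coe _ fun A hA => ?_
  simp only [Proposal.transitionLaw, withDensity_apply _ hA]
  exact (q.measurable_transition x ht).coe_nnreal_ennreal.lintegral_prod_right'

theorem measurable_proposalLaw [SFinite μ] (ht : t < T) :
    Measurable (proposalLaw q x t : (Fin N → Fin t → Z) → Measure (Fin N → Z)) := by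
  have := isProbabilityMeasure_proposalLaw q x (N := N) ht
  have := q.isProbabilityMeasure_transitionLaw x ht
  refine Measurable.measure_of_isPiSystem_of_isProbabilityMeasure
    generateFrom_pi.symm isPiSystem_pi ?_
  rintro _ ⟨A, hA, rfl⟩
  simp only [proposalLaw_eq_pi, Measure.pi_pi]
  exact Finset.measurable_fun_prod _ fun i _ =>
    (Measure.measurable_coe (hA i (Set.mem_univ i))).comp
      ((q.measurable_transitionLaw x ht).comp (measurable_pi_apply i))

end Proposal

section ReachableTransition

variable (p : SequentialModel ν μ T) (q : Proposal X μ T) (x : ℕ → X)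

theorem measurable_incrementalWeight (ht : t < T) :
    Measurable fun a : (Fin t → Z) × Z => incrementalWeight p q x t a.1 a.2 :=
  (p.measurable_transition x ht).div (q.measurable_transition x ht)

theorem measurable_reachableTransition (ht : t < T) :
    Measurable fun a : (Fin t → Z) × Z => reachableTransition p q x t a.1 a.2 :=
  (q.measurable_transition x ht).mul (measurable_incrementalWeight p q x ht)

theorem measurable_chainDensity_reachableTransition (ht : t ≤ T) :
    Measurable (chainDensity (reachableTransition p q x) t) :=
  measurable_chainDensity fun _ hs => measurable_reachableTransition p q x (hs.trans_le ht)

variable {p q x}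

theorem reachableTransition_of_ne_zero {zs : Fin t → Z} {z : Z} (h : q.transition x t zs z ≠ 0) :
    reachableTransition p q x t zs z = p.transition x t zs z :=
  mul_div_cancel₀ _ h

theorem reachableTransition_le (zs : Fin t → Z) (z : Z) :
    reachableTransition p q x t zs z ≤ p.transition x t zs z := by
  rcases eq_or_ne (q.transition x t zs z) 0 with h | h
  · simp [reachableTransition, h]
  · exact (reachableTransition_of_ne_zero h).le

theorem chainDensity_reachableTransition_le (z : Fin t → Z) :
    chainDensity (reachableTransition p q x) t z ≤ p.joint x t z :=
  Finset.prod_le_prod' fun _ _ => reachableTransition_le _ _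

theorem chainDensity_reachableTransition_of_ne_zero {z : Fin t → Z}
    (h : chainDensity (q.transition x) t z ≠ 0) :
    chainDensity (reachableTransition p q x) t z = p.joint x t z :=
  Finset.prod_congr rfl fun s hs =>
    reachableTransition_of_ne_zero (Finset.prod_ne_zero_iff.1 h s hs)

theorem lintegral_incrementalWeight_mul (ht : t < T) (zs : Fin t → Z) {φ : Z → ℝ≥0∞}
    (hφ : Measurable φ) :
    ∫⁻ z, incrementalWeight p q x t zs z * φ z ∂q.transitionLaw x t zs
      = ∫⁻ z, reachableTransition p q x t zs z * φ z ∂μ := by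
  have hq : Measurable (q.transition x t zs) :=
    (q.measurable_transition x ht).comp measurable_prodMk_left
  have hα : Measurable (incrementalWeight p q x t zs) :=
    (measurable_incrementalWeight p q x ht).comp measurable_prodMk_left
  rw [Proposal.transitionLaw, lintegral_withDensity_eq_lintegral_mul _ hq.coe_nnreal_ennreal
    (g := fun z => incrementalWeight p q x t zs z * φ z) (by fun_prop)]
  simp only [reachableTransition, Pi.mul_apply, ENNReal.coe_mul, mul_assoc]

theorem lintegral_incrementalWeight_le (ht : t < T) (zs : Fin t → Z) :
    ∫⁻ z, (incrementalWeight p q x t zs z : ℝ≥0∞) ∂q.transitionLaw x t zs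
      ≤ p.predictive x t zs := by
  have h := lintegral_incrementalWeight_mul (p := p) (q := q) (x := x) ht zs
    (measurable_const (a := 1))
  simp only [mul_one] at h
  exact h.trans_le (lintegral_mono fun z =>
    ENNReal.coe_le_coe.2 (reachableTransition_le zs z))

theorem measurableSet_matchSet [SFinite μ] (ht : t < T) (c : ℝ≥0) :
    MeasurableSet (matchSet p q x t c) :=
  measurableSet_setOf_ae μ (measurableSet_eq_fun (p.measurable_transition x ht)
    ((q.measurable_transition x ht).const_mul c))

theorem ae_incrementalWeight_eq_iff (ht : t < T) {zs : Fin t → Z} {c : ℝ≥0}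
    (hc : p.predictive x t zs = c) :
    (∀ᵐ z ∂q.transitionLaw x t zs, incrementalWeight p q x t zs z = c) ↔
      zs ∈ matchSet p q x t c := by
  have hq : Measurable (q.transition x t zs) :=
    (q.measurable_transition x ht).comp measurable_prodMk_left
  have hp : Measurable (p.transition x t zs) :=
    (p.measurable_transition x ht).comp measurable_prodMk_left
  rw [Proposal.transitionLaw, ae_withDensity_iff hq.coe_nnreal_ennreal]
  simp only [ENNReal.coe_ne_zero]
  exact ae_div_eq_const_iff hp hq (q.lintegral_dens t ht _ zs) hc

end ReachableTransition

end Transition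

noncomputable section Resample

variable {N : ℕ} {w : Fin N → ℝ≥0}

theorem categorical_singleton (w : Fin N → ℝ≥0) (i : Fin N) : categorical w {i} = w i := by
  simp [categorical, Measure.finsetSum_apply, Set.indicator_apply]

theorem lintegral_categorical (w : Fin N → ℝ≥0) (f : Fin N → ℝ≥0∞) :
    ∫⁻ i, f i ∂categorical w = ∑ i, w i * f i := by
  rw [lintegral_fintype]
  exact Finset.sum_congr rfl fun i _ => by rw [categorical_singleton, mul_comm]

theorem categorical_univ (w : Fin N → ℝ≥0) :
    categorical w Set.univ = (∑ i, w i : ℝ≥0) := by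
  rw [← lintegral_one, lintegral_categorical]
  simp

theorem isProbabilityMeasure_categorical (hw : ∑ i, w i = 1) :
    IsProbabilityMeasure (categorical w) :=
  ⟨by rw [categorical_univ, hw, ENNReal.coe_one]⟩

instance : IsFiniteMeasure (categorical w) :=
  ⟨by rw [categorical_univ]; exact ENNReal.coe_lt_top⟩

theorem sum_inv_natCast_eq_one (hN : 0 < N) : ∑ _i : Fin N, (N : ℝ≥0)⁻¹ = 1 := by
  rw [Finset.sum_const, Finset.card_univ, Fintype.card_fin, nsmul_eq_mul]
  exact mul_inv_cancel₀ (by positivity)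

variable {Z : Type*} {t : ℕ}

/-- The state of the filter after a resampling that draws the ancestors `a`. -/
def resampled (s : FilterState Z N t) (a : Fin N → Fin N) : FilterState Z N t :=
  (s.1, fun _ => (N : ℝ≥0)⁻¹, fun i => s.2.2 (a i))

/-- The sum of `φ` over the particles, weighted by the weights and by the likelihood estimate. In
expectation it is an integral with respect to an unnormalized density, see
`lintegral_unnormalizedAverage`. -/
def unnormalizedAverage (φ : (Fin t → Z) → ℝ≥0∞) (s : FilterState Z N t) : ℝ≥0∞ :=
  s.1 * ∑ i, s.2.1 i * φ (s.2.2 i)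

theorem unnormalizedAverage_indicator_eq_zero_iff (A : Set (Fin t → Z)) (s : FilterState Z N t) :
    unnormalizedAverage (Aᶜ.indicator 1) s = 0 ↔ s.1 ≠ 0 → ∀ i, s.2.1 i ≠ 0 → s.2.2 i ∈ A := by
  simp [unnormalizedAverage, Finset.sum_eq_zero_iff, or_iff_not_imp_left]

variable [MeasurableSpace Z]

theorem measurable_unnormalizedAverage {φ : (Fin t → Z) → ℝ≥0∞} (hφ : Measurable φ) :
    Measurable (unnormalizedAverage φ : FilterState Z N t → ℝ≥0∞) := by
  unfold unnormalizedAverage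
  fun_prop

theorem measurable_resampled (a : Fin N → Fin N) :
    Measurable fun s : FilterState Z N t => resampled s a :=
  measurable_fst.prodMk (measurable_const.prodMk (measurable_pi_lambda _ fun i => by fun_prop))

variable (C : Set (Fin N → ℝ≥0)) {s : FilterState Z N t}

theorem resample_of_mem (hC : s.2.1 ∈ C) (hs : ∑ i, s.2.1 i ≠ 0) :
    resample C s = (Measure.pi fun _ : Fin N => categorical s.2.1).map (resampled s) :=
  if_pos ⟨hC, hs⟩

theorem resample_eq_dirac (h : ¬(s.2.1 ∈ C ∧ ∑ i, s.2.1 i ≠ 0)) :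
    resample C s = Measure.dirac s :=
  if_neg h

theorem measurable_resample {C : Set (Fin N → ℝ≥0)} (hC : MeasurableSet C) :
    Measurable (resample C : FilterState Z N t → Measure (FilterState Z N t)) := by
  classical
  refine Measurable.ite ?_ (Measure.measurable_of_measurable_coe _ fun A hA => ?_)
    Measure.measurable_dirac
  · exact (measurable_fst.comp measurable_snd hC).inter ((show Measurable
      fun s : FilterState Z N t => ∑ i, s.2.1 i by fun_prop) (measurableSet_singleton 0).compl)
  · change Measurable fun s : FilterState Z N t =>
      (Measure.pi fun _ : Fin N => categorical s.2.1).map (resampled s) A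
    simp only [← lintegral_indicator_one hA,
      lintegral_map (measurable_one.indicator hA) Measurable.of_discrete, lintegral_fintype,
      Measure.pi_singleton, categorical_singleton]
    refine Finset.measurable_fun_sum _ fun a _ => Measurable.mul ?_ (by fun_prop)
    exact (measurable_one.indicator hA).comp (measurable_resampled a)

theorem isProbabilityMeasure_resample (hs : ∑ i, s.2.1 i = 0 ∨ ∑ i, s.2.1 i = 1) :
    IsProbabilityMeasure (resample C s) := by
  by_cases h : s.2.1 ∈ C ∧ ∑ i, s.2.1 i ≠ 0
  · have := isProbabilityMeasure_categorical (hs.resolve_left h.2)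
    rw [resample_of_mem C h.1 h.2]
    exact Measure.isProbabilityMeasure_map Measurable.of_discrete.aemeasurable
  · rw [resample_eq_dirac C h]
    infer_instance

theorem ae_resample {A : FilterState Z N t → Prop} (hA : MeasurableSet {s | A s}) (hs : A s)
    (hr : ∀ a, A (resampled s a)) : ∀ᵐ s' ∂resample C s, A s' := by
  by_cases h : s.2.1 ∈ C ∧ ∑ i, s.2.1 i ≠ 0
  · rw [resample_of_mem C h.1 h.2, ae_map_iff Measurable.of_discrete.aemeasurable hA]
    exact .of_forall hr
  · rwa [resample_eq_dirac C h, ae_dirac_iff hA]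

theorem ae_resample_estimate_eq (s : FilterState Z N t) :
    ∀ᵐ s' ∂resample C s, s'.1 = s.1 :=
  ae_resample C (measurable_fst (measurableSet_singleton s.1)) rfl fun _ => rfl

theorem lintegral_categorical_pi_average (hN : 0 < N) (hw : ∑ i, w i = 1) (f : Fin N → ℝ≥0∞) :
    ∫⁻ a, ∑ i, ((N : ℝ≥0)⁻¹ : ℝ≥0) * f (a i) ∂(Measure.pi fun _ : Fin N => categorical w)
      = ∑ j, w j * f j := by
  have := isProbabilityMeasure_categorical hw
  rw [lintegral_pi_sum_mul (fun _ => categorical w) fun _ => .of_discrete, ← Finset.sum_mul,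
    ← ENNReal.ofNNReal_finsetSum, sum_inv_natCast_eq_one hN, ENNReal.coe_one, one_mul,
    lintegral_categorical]

theorem lintegral_unnormalizedAverage_resample (hN : 0 < N)
    (hs : ∑ i, s.2.1 i = 0 ∨ ∑ i, s.2.1 i = 1) {φ : (Fin t → Z) → ℝ≥0∞} (hφ : Measurable φ) :
    ∫⁻ s', unnormalizedAverage φ s' ∂resample C s = unnormalizedAverage φ s := by
  by_cases h : s.2.1 ∈ C ∧ ∑ i, s.2.1 i ≠ 0
  · rw [resample_of_mem C h.1 h.2, lintegral_map (measurable_unnormalizedAverage hφ) .of_discrete]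
    simp only [unnormalizedAverage, resampled]
    rw [lintegral_const_mul _ .of_discrete, lintegral_categorical_pi_average hN
      (hs.resolve_left h.2) fun i => φ (s.2.2 i)]
  · rw [resample_eq_dirac C h, lintegral_dirac' _ (measurable_unnormalizedAverage hφ)]

end Resample

section Bind

variable {A B D : Type*} [MeasurableSpace A] [MeasurableSpace B] [MeasurableSpace D]
  {κ : A → Measure B}

theorem measurable_bind_prodMk (hκ : Measurable κ) [∀ a, IsProbabilityMeasure (κ a)]
    {f : A × B → Measure D} (hf : Measurable f) :
    Measurable fun a => (κ a).bind fun b => f (a, b) := by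
  refine Measure.measurable_of_measurable_coe _ fun S hS => ?_
  have hfa (a : A) : Measurable fun b => f (a, b) := hf.comp measurable_prodMk_left
  simp only [fun a => Measure.bind_apply (m := κ a) hS (hfa a).aemeasurable]
  let K : ProbabilityTheory.Kernel A B := ⟨κ, hκ⟩
  have : ProbabilityTheory.IsMarkovKernel K :=
    ⟨fun a => inferInstanceAs (IsProbabilityMeasure (κ a))⟩
  exact ((Measure.measurable_coe hS).comp hf).lintegral_kernel_prod_right' (κ := K)

theorem ae_bind_iff (hκ : Measurable κ) (P : Measure A) {S : B → Prop}
    (hS : MeasurableSet {b | S b}) :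
    (∀ᵐ b ∂P.bind κ, S b) ↔ ∀ᵐ a ∂P, ∀ᵐ b ∂κ a, S b :=
  Measure.ae_comp_iff (κ := ⟨κ, hκ⟩) hS

end Bind

noncomputable section FilterLaw

variable {X Z : Type*} [MeasurableSpace X] [MeasurableSpace Z]
  {ν : Measure X} {μ : Measure Z} {T N t : ℕ}

theorem measurableSet_estimate_eq (c : ℝ≥0) :
    MeasurableSet {s : FilterState Z N t | s.1 = c} :=
  measurable_fst (measurableSet_singleton c)

theorem measurableSet_sum_weight_eq (c : ℝ≥0) :
    MeasurableSet {s : FilterState Z N t | ∑ i, s.2.1 i = c} :=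
  (show Measurable fun s : FilterState Z N t => ∑ i, s.2.1 i by fun_prop)
    (measurableSet_singleton c)

/-- The factor by which the likelihood estimate is multiplied when the latents `z` are proposed in
the state `s`. -/
def increment (p : SequentialModel ν μ T) (q : Proposal X μ T) (x : ℕ → X) (t : ℕ)
    (s : FilterState Z N t) (z : Fin N → Z) : ℝ≥0 :=
  ∑ i, s.2.1 i * incrementalWeight p q x t (s.2.2 i) (z i)

/-- The law of the next state of the particle filter, given the current one, when `C` is the
resampling criterion. -/
def filterStep (C : Set (Fin N → ℝ≥0)) (p : SequentialModel ν μ T) (q : Proposal X μ T)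
    (x : ℕ → X) (t : ℕ) (s : FilterState Z N t) : Measure (FilterState Z N (t + 1)) :=
  (proposalLaw q x t s.2.2).bind fun z => resample C (reweight p q x t s z)

section Reweight

variable (p : SequentialModel ν μ T) (q : Proposal X μ T) (x : ℕ → X)

theorem reweight_estimate (s : FilterState Z N t) (z : Fin N → Z) :
    (reweight p q x t s z).1 = s.1 * increment p q x t s z := rfl

theorem sum_reweight_weight (s : FilterState Z N t) (z : Fin N → Z) :
    ∑ i, (reweight p q x t s z).2.1 i = increment p q x t s z / increment p q x t s z :=
  (Finset.sum_div _ _ _).symm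

theorem sum_reweight_weight_eq_zero_or (s : FilterState Z N t) (z : Fin N → Z) :
    ∑ i, (reweight p q x t s z).2.1 i = 0 ∨ ∑ i, (reweight p q x t s z).2.1 i = 1 := by
  rw [sum_reweight_weight]
  rcases eq_or_ne (increment p q x t s z) 0 with h | h
  · exact .inl (by rw [h, div_zero])
  · exact .inr (div_self h)

theorem reweight_estimate_eq_zero_or (s : FilterState Z N t) (z : Fin N → Z) :
    (reweight p q x t s z).1 = 0 ∨ ∑ i, (reweight p q x t s z).2.1 i = 1 := by
  rw [reweight_estimate, sum_reweight_weight]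
  rcases eq_or_ne (increment p q x t s z) 0 with h | h
  · exact .inl (by rw [h, mul_zero])
  · exact .inr (div_self h)

theorem increment_mul_reweight_weight (s : FilterState Z N t) (z : Fin N → Z) (i : Fin N) :
    increment p q x t s z * (reweight p q x t s z).2.1 i
      = s.2.1 i * incrementalWeight p q x t (s.2.2 i) (z i) :=
  mul_div_cancel_of_imp' fun h => Finset.sum_eq_zero_iff.1 h i (Finset.mem_univ i)

theorem unnormalizedAverage_reweight (φ : (Fin (t + 1) → Z) → ℝ≥0∞) (s : FilterState Z N t)
    (z : Fin N → Z) :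
    unnormalizedAverage φ (reweight p q x t s z)
      = s.1 * ∑ i, s.2.1 i *
          (incrementalWeight p q x t (s.2.2 i) (z i) * φ (concat (s.2.2 i) (z i))) := by
  rw [unnormalizedAverage, reweight_estimate, ENNReal.coe_mul, mul_assoc, Finset.mul_sum]
  congr 1
  refine Finset.sum_congr rfl fun i _ => ?_
  rw [← mul_assoc, ← mul_assoc, ← ENNReal.coe_mul, ← ENNReal.coe_mul,
    increment_mul_reweight_weight]
  rfl

variable {p q x}

theorem measurable_weight_mul_incrementalWeight (ht : t < T) (i : Fin N) :
    Measurable fun a : FilterState Z N t × (Fin N → Z) =>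
      a.1.2.1 i * incrementalWeight p q x t (a.1.2.2 i) (a.2 i) :=
  Measurable.mul (by fun_prop) ((measurable_incrementalWeight p q x ht).comp
    (f := fun a : FilterState Z N t × (Fin N → Z) => (a.1.2.2 i, a.2 i)) (by fun_prop))

theorem measurable_increment (ht : t < T) :
    Measurable fun a : FilterState Z N t × (Fin N → Z) => increment p q x t a.1 a.2 :=
  Finset.measurable_fun_sum _ fun i _ => measurable_weight_mul_incrementalWeight ht i

theorem measurable_reweight (ht : t < T) :
    Measurable fun a : FilterState Z N t × (Fin N → Z) => reweight p q x t a.1 a.2 := by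
  refine (measurable_fst.fst.mul (measurable_increment ht)).prodMk (Measurable.prodMk ?_ ?_)
  · exact measurable_pi_lambda _ fun i =>
      (measurable_weight_mul_incrementalWeight ht i).div (measurable_increment ht)
  · exact measurable_pi_lambda _ fun i => measurable_concat.comp
      (f := fun a : FilterState Z N t × (Fin N → Z) => (a.1.2.2 i, a.2 i)) (by fun_prop)

end Reweight

section Step

variable {p : SequentialModel ν μ T} {q : Proposal X μ T} {x : ℕ → X} {C : Set (Fin N → ℝ≥0)}

theorem measurable_resample_reweight (hC : MeasurableSet C) (ht : t < T) :
    Measurable fun a : FilterState Z N t × (Fin N → Z) => resample C (reweight p q x t a.1 a.2) :=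
  (measurable_resample hC).comp (measurable_reweight ht)

theorem measurable_resample_reweight_right (hC : MeasurableSet C) (ht : t < T)
    (s : FilterState Z N t) :
    Measurable fun z : Fin N → Z => resample C (reweight p q x t s z) := by
  have hs : Measurable fun z : Fin N → Z => reweight p q x t s z :=
    (measurable_reweight ht).comp (f := fun z : Fin N → Z => (s, z)) measurable_prodMk_left
  exact (measurable_resample hC).comp hs

theorem measurable_filterStep [SigmaFinite μ] (hC : MeasurableSet C) (ht : t < T) :
    Measurable (filterStep C p q x t) := by
  have (s : FilterState Z N t) : IsProbabilityMeasure (proposalLaw q x t s.2.2) :=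
    isProbabilityMeasure_proposalLaw q x ht s.2.2
  have hlaw : Measurable fun s : FilterState Z N t => proposalLaw q x t s.2.2 :=
    (measurable_proposalLaw q x ht).comp (measurable_snd.comp measurable_snd)
  have hres := measurable_resample_reweight (p := p) (q := q) (x := x) hC ht
  have hbind := measurable_bind_prodMk hlaw hres
  exact hbind

theorem isProbabilityMeasure_filterStep (hC : MeasurableSet C) (ht : t < T)
    (s : FilterState Z N t) : IsProbabilityMeasure (filterStep C p q x t s) := by
  have := isProbabilityMeasure_proposalLaw q x ht s.2.2
  exact isProbabilityMeasure_bind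
    (measurable_resample_reweight_right hC ht s).aemeasurable
    (.of_forall fun z =>
      isProbabilityMeasure_resample C (sum_reweight_weight_eq_zero_or p q x s z))

theorem ae_filterStep_iff (hC : MeasurableSet C) (ht : t < T) (s : FilterState Z N t)
    {A : FilterState Z N (t + 1) → Prop} (hA : MeasurableSet {s' | A s'}) :
    (∀ᵐ s' ∂filterStep C p q x t s, A s') ↔
      ∀ᵐ z ∂proposalLaw q x t s.2.2, ∀ᵐ s' ∂resample C (reweight p q x t s z), A s' :=
  ae_bind_iff (measurable_resample_reweight_right hC ht s) _ hA

theorem ae_estimate_filterStep_iff (hC : MeasurableSet C) (ht : t < T) (s : FilterState Z N t)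
    (c : ℝ≥0) :
    (∀ᵐ s' ∂filterStep C p q x t s, s'.1 = c) ↔
      ∀ᵐ z ∂proposalLaw q x t s.2.2, s.1 * increment p q x t s z = c := by
  rw [ae_filterStep_iff hC ht s (measurableSet_estimate_eq c)]
  refine Filter.eventually_congr (.of_forall fun z => ?_)
  have := isProbabilityMeasure_resample C (sum_reweight_weight_eq_zero_or p q x s z)
  rw [Filter.eventually_congr ((ae_resample_estimate_eq C _).mono fun s' hs' => by rw [hs']),
    Filter.eventually_const, reweight_estimate]

theorem ae_filterStep_estimate_eq_zero_or (hN : 0 < N) (hC : MeasurableSet C) (ht : t < T)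
    (s : FilterState Z N t) :
    ∀ᵐ s' ∂filterStep C p q x t s, s'.1 = 0 ∨ ∑ i, s'.2.1 i = 1 := by
  have hA : MeasurableSet {s' : FilterState Z N (t + 1) | s'.1 = 0 ∨ ∑ i, s'.2.1 i = 1} :=
    (measurableSet_estimate_eq 0).union (measurableSet_sum_weight_eq 1)
  rw [ae_filterStep_iff hC ht s hA]
  exact .of_forall fun z => ae_resample C hA (reweight_estimate_eq_zero_or p q x s z)
    fun _ => .inr (sum_inv_natCast_eq_one hN)

theorem lintegral_unnormalizedAverage_filterStep (hN : 0 < N) (hC : MeasurableSet C) (ht : t < T)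
    (s : FilterState Z N t) {φ : (Fin (t + 1) → Z) → ℝ≥0∞} (hφ : Measurable φ) :
    ∫⁻ s', unnormalizedAverage φ s' ∂filterStep C p q x t s
      = unnormalizedAverage
          (fun z => ∫⁻ z', reachableTransition p q x t z z' * φ (concat z z') ∂μ) s := by
  have (i : Fin N) := q.isProbabilityMeasure_transitionLaw x ht (s.2.2 i)
  have hφs (i : Fin N) : Measurable fun z' => φ (concat (s.2.2 i) z') :=
    hφ.comp (measurable_concat.comp measurable_prodMk_left)
  have hαφ (i : Fin N) : Measurable fun z' : Z =>
      (incrementalWeight p q x t (s.2.2 i) z' : ℝ≥0∞) * φ (concat (s.2.2 i) z') :=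
    ((measurable_incrementalWeight p q x ht).comp
      measurable_prodMk_left).coe_nnreal_ennreal.mul (hφs i)
  have hαφ' (i : Fin N) : Measurable fun z : Fin N → Z =>
      (incrementalWeight p q x t (s.2.2 i) (z i) : ℝ≥0∞) * φ (concat (s.2.2 i) (z i)) :=
    (hαφ i).comp (measurable_pi_apply i)
  rw [filterStep, Measure.lintegral_bind
    (measurable_resample_reweight_right hC ht s).aemeasurable
    (measurable_unnormalizedAverage hφ).aemeasurable]
  simp only [lintegral_unnormalizedAverage_resample C hN
    (sum_reweight_weight_eq_zero_or p q x s _) hφ, unnormalizedAverage_reweight]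
  rw [lintegral_const_mul _ (Finset.measurable_fun_sum _ fun i _ => (hαφ' i).const_mul _),
    proposalLaw_eq_pi, lintegral_pi_sum_mul _ hαφ, unnormalizedAverage]
  simp only [lintegral_incrementalWeight_mul ht _ (hφs _)]

end Step

variable {C : ℕ → Set (Fin N → ℝ≥0)} {p : SequentialModel ν μ T}
  {q : Proposal X μ T} {x : ℕ → X}

theorem filterLaw_succ (t : ℕ) :
    filterLaw C p q x (t + 1) = (filterLaw C p q x t).bind (filterStep (C t) p q x t) := rfl

variable [SigmaFinite μ]

theorem isProbabilityMeasure_filterLaw (hC : ∀ t, MeasurableSet (C t)) (ht : t ≤ T) :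
    IsProbabilityMeasure (filterLaw C p q x t) := by
  induction t with
  | zero => exact Measure.dirac.isProbabilityMeasure
  | succ t ih =>
    have := ih (Nat.le_of_succ_le ht)
    exact isProbabilityMeasure_bind (measurable_filterStep (hC t) ht).aemeasurable
      (.of_forall (isProbabilityMeasure_filterStep (hC t) ht))

theorem ae_estimate_filterLaw_succ_iff (hC : ∀ t, MeasurableSet (C t)) (ht : t < T) (c : ℝ≥0) :
    (∀ᵐ s ∂filterLaw C p q x (t + 1), s.1 = c) ↔
      ∀ᵐ s ∂filterLaw C p q x t, ∀ᵐ z ∂proposalLaw q x t s.2.2,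
        s.1 * increment p q x t s z = c := by
  rw [filterLaw_succ, ae_bind_iff (measurable_filterStep (hC t) ht) _
    (measurableSet_estimate_eq c)]
  exact Filter.eventually_congr (.of_forall fun s => ae_estimate_filterStep_iff (hC t) ht s c)

theorem ae_filterLaw_estimate_eq_zero_or (hN : 0 < N) (hC : ∀ t, MeasurableSet (C t))
    (ht : t ≤ T) : ∀ᵐ s ∂filterLaw C p q x t, s.1 = 0 ∨ ∑ i, s.2.1 i = 1 := by
  have hA : MeasurableSet {s : FilterState Z N t | s.1 = 0 ∨ ∑ i, s.2.1 i = 1} :=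
    (measurableSet_estimate_eq 0).union (measurableSet_sum_weight_eq 1)
  cases t with
  | zero =>
    rw [filterLaw, ae_dirac_iff hA]
    exact .inr (sum_inv_natCast_eq_one hN)
  | succ t =>
    rw [filterLaw_succ, ae_bind_iff (measurable_filterStep (hC t) ht) _ hA]
    exact .of_forall (ae_filterStep_estimate_eq_zero_or hN (hC t) ht)

theorem lintegral_unnormalizedAverage (hN : 0 < N) (hC : ∀ t, MeasurableSet (C t)) (ht : t ≤ T)
    {φ : (Fin t → Z) → ℝ≥0∞} (hφ : Measurable φ) :
    ∫⁻ s, unnormalizedAverage φ s ∂filterLaw C p q x t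
      = ∫⁻ z, chainDensity (reachableTransition p q x) t z * φ z
          ∂Measure.pi fun _ : Fin t => μ := by
  induction t with
  | zero =>
    rw [filterLaw, lintegral_dirac' _ (measurable_unnormalizedAverage hφ), lintegral_pi_fin_zero,
      chainDensity_zero]
    simp only [unnormalizedAverage, ← Finset.sum_mul, ← ENNReal.ofNNReal_finsetSum,
      sum_inv_natCast_eq_one hN, ENNReal.coe_one, one_mul]
  | succ t ih =>
    have hr := measurable_reachableTransition p q x ht
    have hrφ : Measurable fun a : (Fin t → Z) × Z =>
        (reachableTransition p q x t a.1 a.2 : ℝ≥0∞) * φ (concat a.1 a.2) :=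
      hr.coe_nnreal_ennreal.mul (hφ.comp measurable_concat)
    rw [filterLaw_succ, Measure.lintegral_bind (measurable_filterStep (hC t) ht).aemeasurable
      (measurable_unnormalizedAverage hφ).aemeasurable]
    simp only [lintegral_unnormalizedAverage_filterStep hN (hC t) ht _ hφ]
    have hdens : Measurable fun z =>
        (chainDensity (reachableTransition p q x) (t + 1) z : ℝ≥0∞) * φ z :=
      (measurable_chainDensity_reachableTransition p q x ht).coe_nnreal_ennreal.mul hφ
    rw [ih (Nat.le_of_succ_le ht) hrφ.lintegral_prod_right', lintegral_pi_fin_succ μ hdens]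
    refine lintegral_congr fun z => ?_
    simp only [chainDensity_concat, ENNReal.coe_mul, mul_assoc]
    exact (lintegral_const_mul _ (hrφ.comp measurable_prodMk_left)).symm

theorem lintegral_estimate_le_evidence (hN : 0 < N) (hC : ∀ t, MeasurableSet (C t)) (ht : t ≤ T) :
    ∫⁻ s, (s.1 : ℝ≥0∞) ∂filterLaw C p q x t ≤ p.evidence x t :=
  calc ∫⁻ s, (s.1 : ℝ≥0∞) ∂filterLaw C p q x t
      = ∫⁻ s, unnormalizedAverage 1 s ∂filterLaw C p q x t := by
        refine lintegral_congr_ae ((ae_filterLaw_estimate_eq_zero_or hN hC ht).mono fun s hs => ?_)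
        rcases hs with hs | hs
        · simp only [unnormalizedAverage, hs, ENNReal.coe_zero, zero_mul]
        · simp only [unnormalizedAverage, Pi.one_apply, mul_one, ← ENNReal.ofNNReal_finsetSum, hs,
            ENNReal.coe_one]
    _ = ∫⁻ z, chainDensity (reachableTransition p q x) t z * 1 ∂Measure.pi fun _ : Fin t => μ :=
        lintegral_unnormalizedAverage hN hC ht measurable_one
    _ ≤ p.evidence x t := lintegral_mono fun z => by
        rw [mul_one]
        exact ENNReal.coe_le_coe.2 (chainDensity_reachableTransition_le z)

theorem ae_weight_ne_zero_mem_iff (hN : 0 < N) (hC : ∀ t, MeasurableSet (C t)) (ht : t ≤ T)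
    {A : Set (Fin t → Z)} (hA : MeasurableSet A) :
    (∀ᵐ s ∂filterLaw C p q x t, s.1 ≠ 0 → ∀ i, s.2.1 i ≠ 0 → s.2.2 i ∈ A) ↔
      ∀ᵐ z ∂Measure.pi fun _ : Fin t => μ,
        chainDensity (reachableTransition p q x) t z ≠ 0 → z ∈ A := by
  have hφ : Measurable (Aᶜ.indicator (1 : (Fin t → Z) → ℝ≥0∞)) := measurable_one.indicator hA.compl
  have hr := measurable_chainDensity_reachableTransition p q x ht
  calc _ ↔ ∀ᵐ s ∂filterLaw C p q x t, unnormalizedAverage (Aᶜ.indicator 1) s = 0 :=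
        Filter.eventually_congr (.of_forall fun s =>
          (unnormalizedAverage_indicator_eq_zero_iff A s).symm)
    _ ↔ ∀ᵐ z ∂Measure.pi fun _ : Fin t => μ,
          (chainDensity (reachableTransition p q x) t z : ℝ≥0∞) * Aᶜ.indicator 1 z = 0 := by
        have h := lintegral_unnormalizedAverage (p := p) (q := q) (x := x) hN hC ht hφ
        have hleft := lintegral_eq_zero_iff (μ := filterLaw C p q x t)
          (measurable_unnormalizedAverage hφ)
        have hright := lintegral_eq_zero_iff (μ := Measure.pi fun _ : Fin t => μ)
          (hr.coe_nnreal_ennreal.mul hφ)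
        exact hleft.symm.trans ((iff_of_eq (congrArg (· = 0) h)).trans hright)
    _ ↔ _ := by simp [or_iff_not_imp_left]

end FilterLaw

noncomputable section ConstantPrediction

variable {X Z : Type*} [MeasurableSpace X] [MeasurableSpace Z]
  {ν : Measure X} {μ : Measure Z} {T N t : ℕ}

section Increment

variable {p : SequentialModel ν μ T} {q : Proposal X μ T} {x : ℕ → X} {s : FilterState Z N t}
  {c : ℝ≥0}

theorem ae_increment_eq_iff (ht : t < T) (hw : ∑ i, s.2.1 i = 1)
    (hpred : ∀ i, s.2.1 i ≠ 0 → p.predictive x t (s.2.2 i) = c) :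
    (∀ᵐ z ∂proposalLaw q x t s.2.2, increment p q x t s z = c) ↔
      ∀ i, s.2.1 i ≠ 0 → s.2.2 i ∈ matchSet p q x t c := by
  have (i : Fin N) := q.isProbabilityMeasure_transitionLaw x ht (s.2.2 i)
  rw [proposalLaw_eq_pi]
  exact (ae_sum_mul_eq_iff _ hw
    (fun i => (measurable_incrementalWeight p q x ht).comp measurable_prodMk_left)
    fun i hi => (lintegral_incrementalWeight_le ht _).trans_eq (hpred i hi)).trans
    (forall₂_congr fun i hi => ae_incrementalWeight_eq_iff ht (hpred i hi))

theorem lintegral_increment_le (ht : t < T) (hw : ∑ i, s.2.1 i = 1)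
    (hpred : ∀ i, s.2.1 i ≠ 0 → p.predictive x t (s.2.2 i) = c) :
    ∫⁻ z, (increment p q x t s z : ℝ≥0∞) ∂proposalLaw q x t s.2.2 ≤ c := by
  have (i : Fin N) := q.isProbabilityMeasure_transitionLaw x ht (s.2.2 i)
  have hα (i : Fin N) :
      Measurable fun z => (incrementalWeight p q x t (s.2.2 i) z : ℝ≥0∞) :=
    ((measurable_incrementalWeight p q x ht).comp measurable_prodMk_left).coe_nnreal_ennreal
  simp only [increment, ENNReal.ofNNReal_finsetSum, ENNReal.coe_mul]
  rw [proposalLaw_eq_pi, lintegral_pi_sum_mul _ hα]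
  calc ∑ i, s.2.1 i * ∫⁻ z, (incrementalWeight p q x t (s.2.2 i) z : ℝ≥0∞)
          ∂q.transitionLaw x t (s.2.2 i)
      ≤ ∑ i, (s.2.1 i : ℝ≥0∞) * c := Finset.sum_le_sum fun i _ => by
        rcases eq_or_ne (s.2.1 i) 0 with hi | hi
        · simp [hi]
        · exact mul_le_mul_right ((lintegral_incrementalWeight_le ht _).trans_eq (hpred i hi)) _
    _ = c := by
        rw [← Finset.sum_mul, ← ENNReal.ofNNReal_finsetSum, hw, ENNReal.coe_one, one_mul]

theorem le_estimate_of_ae_mul_increment_eq (ht : t < T) (hw : ∑ i, s.2.1 i = 1)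
    (hpred : ∀ i, s.2.1 i ≠ 0 → p.predictive x t (s.2.2 i) = c) (hc : c ≠ 0) {e : ℝ≥0}
    (h : ∀ᵐ z ∂proposalLaw q x t s.2.2, s.1 * increment p q x t s z = e * c) : e ≤ s.1 := by
  have := isProbabilityMeasure_proposalLaw q x ht s.2.2
  have hinc : Measurable fun z => (increment p q x t s z : ℝ≥0∞) :=
    ((measurable_increment ht).comp measurable_prodMk_left).coe_nnreal_ennreal
  have hmean : (e * c : ℝ≥0∞) ≤ s.1 * c :=
    calc (e * c : ℝ≥0∞)
        = ∫⁻ z, s.1 * increment p q x t s z ∂proposalLaw q x t s.2.2 := by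
          have hcoe : ∀ᵐ z ∂proposalLaw q x t s.2.2,
              (s.1 * increment p q x t s z : ℝ≥0∞) = e * c := h.mono fun z hz => mod_cast hz
          rw [lintegral_congr_ae hcoe, lintegral_const, measure_univ, mul_one]
      _ = s.1 * ∫⁻ z, increment p q x t s z ∂proposalLaw q x t s.2.2 := lintegral_const_mul _ hinc
      _ ≤ s.1 * c := mul_le_mul_right (lintegral_increment_le ht hw hpred) _
  exact le_of_mul_le_mul_right (by exact_mod_cast hmean) (pos_iff_ne_zero.2 hc)

end Increment

/-- Along the observation sequence `x`, the predictive density of the observation number `t` is a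
nonzero constant `c t` on the latents charged by the model. -/
structure HasConstantPrediction (p : SequentialModel ν μ T) (x : ℕ → X) (c : ℕ → ℝ≥0) : Prop where
  ne_zero : ∀ t < T, c t ≠ 0
  predictive_eq : ∀ t < T, ∀ᵐ z ∂Measure.pi fun _ : Fin t => μ,
    p.joint x t z ≠ 0 → p.predictive x t z = c t

theorem HasConstantPrediction.prod_ne_zero {p : SequentialModel ν μ T} {x : ℕ → X} {c : ℕ → ℝ≥0}
    (h : HasConstantPrediction p x c) (ht : t ≤ T) : ∏ s ∈ Finset.range t, c s ≠ 0 :=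
  Finset.prod_ne_zero_iff.2 fun s hs => h.ne_zero s ((Finset.mem_range.1 hs).trans_le ht)

theorem SequentialModel.evidence_zero (p : SequentialModel ν μ T) (x : ℕ → X) :
    p.evidence x 0 = 1 := by
  rw [SequentialModel.evidence, lintegral_pi_fin_zero, p.joint_eq_chainDensity, chainDensity_zero,
    ENNReal.coe_one]

theorem SequentialModel.lintegral_joint_concat (p : SequentialModel ν μ T) (x : ℕ → X)
    (ht : t < T) (z : Fin t → Z) :
    ∫⁻ z', (p.joint x (t + 1) (concat z z') : ℝ≥0∞) ∂μ = p.joint x t z * p.predictive x t z := by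
  simp only [SequentialModel.joint_concat, ENNReal.coe_mul]
  exact lintegral_const_mul _
    ((p.measurable_transition x ht).comp measurable_prodMk_left).coe_nnreal_ennreal

variable [SigmaFinite μ]

theorem SequentialModel.evidence_succ (p : SequentialModel ν μ T) (x : ℕ → X) (ht : t < T) :
    p.evidence x (t + 1)
      = ∫⁻ z, p.joint x t z * p.predictive x t z ∂Measure.pi fun _ : Fin t => μ := by
  rw [SequentialModel.evidence,
    lintegral_pi_fin_succ μ (p.measurable_joint x ht).coe_nnreal_ennreal]
  simp only [p.lintegral_joint_concat x ht]

namespace HasConstantPrediction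

variable {p : SequentialModel ν μ T} {q : Proposal X μ T} {x : ℕ → X} {c : ℕ → ℝ≥0}
  (h : HasConstantPrediction p x c)

include h

theorem evidence_eq (ht : t ≤ T) : p.evidence x t = (∏ s ∈ Finset.range t, c s : ℝ≥0) := by
  induction t with
  | zero => rw [p.evidence_zero, Finset.prod_range_zero, ENNReal.coe_one]
  | succ t ih =>
    rw [p.evidence_succ x ht, Finset.prod_range_succ, ENNReal.coe_mul, ← ih (Nat.le_of_succ_le ht),
      SequentialModel.evidence,
      ← lintegral_mul_const _ (p.measurable_joint x (Nat.le_of_succ_le ht)).coe_nnreal_ennreal]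
    refine lintegral_congr_ae ((h.predictive_eq t ht).mono fun z hz => ?_)
    rcases eq_or_ne (p.joint x t z) 0 with h0 | h0
    · simp only [h0, ENNReal.coe_zero, zero_mul]
    · simp only [hz h0]

theorem ae_joint_succ_eq_iff (ht : t < T) :
    (∀ᵐ z ∂Measure.pi fun _ : Fin (t + 1) => μ, p.joint x (t + 1) z
        = (∏ s ∈ Finset.range (t + 1), c s) * chainDensity (q.transition x) (t + 1) z) ↔
      (∀ᵐ z ∂Measure.pi fun _ : Fin t => μ,
        p.joint x t z = (∏ s ∈ Finset.range t, c s) * chainDensity (q.transition x) t z) ∧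
      ∀ᵐ z ∂Measure.pi fun _ : Fin t => μ, p.joint x t z ≠ 0 → z ∈ matchSet p q x t (c t) := by
  rw [ae_pi_fin_succ_iff μ (measurableSet_eq_fun (p.measurable_joint x ht)
    ((q.measurable_chainDensity_transition x ht).const_mul _)), ← Filter.eventually_and]
  refine Filter.eventually_congr ((h.predictive_eq t ht).mono fun z hz => ?_)
  have hp : Measurable (p.transition x t z) :=
    (p.measurable_transition x ht).comp measurable_prodMk_left
  have hq : Measurable (q.transition x t z) :=
    (q.measurable_transition x ht).comp measurable_prodMk_left
  have hstep := ae_mul_eq_mul_iff hp hq (q.lintegral_dens t ht _ z) (h.ne_zero t ht) hz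
    (b := (∏ s ∈ Finset.range t, c s) * chainDensity (q.transition x) t z)
  simp only [p.joint_concat, chainDensity_concat, Finset.prod_range_succ_comm]
  simpa only [mul_assoc, matchSet, Set.mem_ofPred_eq] using hstep

variable {C : ℕ → Set (Fin N → ℝ≥0)}

theorem ae_filterLaw_predictive_eq (hN : 0 < N) (hC : ∀ t, MeasurableSet (C t)) (ht : t < T) :
    ∀ᵐ s ∂filterLaw C p q x t,
      s.1 ≠ 0 → ∀ i, s.2.1 i ≠ 0 → p.predictive x t (s.2.2 i) = c t := by
  refine (ae_weight_ne_zero_mem_iff hN hC ht.le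
    (p.measurable_predictive x ht (measurableSet_singleton (c t : ℝ≥0∞)))).2 ?_
  filter_upwards [h.predictive_eq t ht] with z hz hr
  refine hz fun h0 => hr ?_
  exact nonpos_iff_eq_zero.1 ((chainDensity_reachableTransition_le z).trans_eq h0)

/-- The conditional mean of an increment is at most `c t`, so an exact estimate at time `t + 1`
forces the estimate at time `t` not to fall below the evidence; its mean then makes it exact. -/
theorem ae_estimate_eq_of_succ (hN : 0 < N) (hC : ∀ t, MeasurableSet (C t)) (ht : t < T)
    (hsucc : ∀ᵐ s ∂filterLaw C p q x t, ∀ᵐ z ∂proposalLaw q x t s.2.2,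
      s.1 * increment p q x t s z = (∏ s ∈ Finset.range t, c s) * c t) :
    ∀ᵐ s ∂filterLaw C p q x t, s.1 = ∏ s ∈ Finset.range t, c s := by
  have := isProbabilityMeasure_filterLaw (p := p) (q := q) (x := x) hC ht.le
  have hle : ∀ᵐ s ∂filterLaw C p q x t, ((∏ s ∈ Finset.range t, c s : ℝ≥0) : ℝ≥0∞) ≤ s.1 := by
    filter_upwards [hsucc, ae_filterLaw_estimate_eq_zero_or hN hC ht.le,
      h.ae_filterLaw_predictive_eq hN hC ht] with s hs hw hpred
    have := isProbabilityMeasure_proposalLaw q x ht s.2.2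
    have hs0 : s.1 ≠ 0 := fun h0 => by
      obtain ⟨z, hz⟩ := hs.exists
      exact mul_ne_zero (h.prod_ne_zero ht.le) (h.ne_zero t ht) (by rw [← hz, h0, zero_mul])
    exact ENNReal.coe_le_coe.2 (le_estimate_of_ae_mul_increment_eq ht (hw.resolve_left hs0)
      (hpred hs0) (h.ne_zero t ht) hs)
  have hconst : ∫⁻ _s : FilterState Z N t, ((∏ s ∈ Finset.range t, c s : ℝ≥0) : ℝ≥0∞)
      ∂filterLaw C p q x t = p.evidence x t := by
    rw [lintegral_const, measure_univ, mul_one, h.evidence_eq ht.le]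
  have hfin := (h.evidence_eq ht.le).trans_ne ENNReal.coe_ne_top
  filter_upwards [ae_eq_of_ae_le_of_lintegral_le hle (hconst.trans_ne hfin)
    measurable_fst.coe_nnreal_ennreal.aemeasurable
    ((lintegral_estimate_le_evidence hN hC ht.le).trans_eq hconst.symm)] with s hs
  exact_mod_cast hs.symm

theorem ae_estimate_succ_eq_iff (hN : 0 < N) (hC : ∀ t, MeasurableSet (C t)) (ht : t < T) :
    (∀ᵐ s ∂filterLaw C p q x (t + 1), s.1 = ∏ s ∈ Finset.range (t + 1), c s) ↔
      (∀ᵐ s ∂filterLaw C p q x t, s.1 = ∏ s ∈ Finset.range t, c s) ∧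
      ∀ᵐ z ∂Measure.pi fun _ : Fin t => μ,
        chainDensity (reachableTransition p q x) t z ≠ 0 → z ∈ matchSet p q x t (c t) := by
  rw [ae_estimate_filterLaw_succ_iff hC ht,
    ← ae_weight_ne_zero_mem_iff hN hC ht.le (measurableSet_matchSet ht (c t)),
    ← Filter.eventually_and, Finset.prod_range_succ]
  have hexact (hest : ∀ᵐ s ∂filterLaw C p q x t, s.1 = ∏ s ∈ Finset.range t, c s) :
      ∀ᵐ s ∂filterLaw C p q x t, s.1 = (∏ s ∈ Finset.range t, c s) ∧
        ((∀ᵐ z ∂proposalLaw q x t s.2.2,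
          s.1 * increment p q x t s z = (∏ s ∈ Finset.range t, c s) * c t) ↔
        (s.1 ≠ 0 → ∀ i, s.2.1 i ≠ 0 → s.2.2 i ∈ matchSet p q x t (c t))) := by
    filter_upwards [hest, ae_filterLaw_estimate_eq_zero_or hN hC ht.le,
      h.ae_filterLaw_predictive_eq hN hC ht] with s hs hw hpred
    have hs0 : s.1 ≠ 0 := hs ▸ h.prod_ne_zero ht.le
    simp only [← hs, mul_right_inj' hs0, hs0, ne_eq, not_false_eq_true, forall_true_left, true_and]
    exact ae_increment_eq_iff ht (hw.resolve_left hs0) (hpred hs0)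
  constructor
  · intro hsucc
    filter_upwards [hsucc, hexact (h.ae_estimate_eq_of_succ hN hC ht hsucc)] with s hs hiff
    exact ⟨hiff.1, hiff.2.1 hs⟩
  · intro hmatch
    filter_upwards [hmatch, hexact (hmatch.mono fun s hs => hs.1)] with s hs hiff
    exact hiff.2.2 hs.2

theorem ae_estimate_eq_iff (hN : 0 < N) (hC : ∀ t, MeasurableSet (C t)) (ht : t ≤ T) :
    (∀ᵐ s ∂filterLaw C p q x t, s.1 = ∏ s ∈ Finset.range t, c s) ↔
      ∀ᵐ z ∂Measure.pi fun _ : Fin t => μ,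
        p.joint x t z = (∏ s ∈ Finset.range t, c s) * chainDensity (q.transition x) t z := by
  induction t with
  | zero =>
    rw [filterLaw, ae_dirac_iff (measurableSet_estimate_eq _)]
    simp only [p.joint_eq_chainDensity, chainDensity_zero, Finset.prod_range_zero, mul_one,
      Filter.eventually_true]
  | succ t ih =>
    rw [h.ae_estimate_succ_eq_iff hN hC ht, h.ae_joint_succ_eq_iff ht,
      ih (Nat.le_of_succ_le ht)]
    refine and_congr_right fun hjoint => Filter.eventually_congr (hjoint.mono fun z hz => ?_)
    refine imp_congr_left (not_congr ⟨fun hr => ?_, fun hp => ?_⟩)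
    · by_contra hp
      have hq : chainDensity (q.transition x) t z ≠ 0 := right_ne_zero_of_mul (hz ▸ hp)
      exact hp ((chainDensity_reachableTransition_of_ne_zero hq).symm.trans hr)
    · exact nonpos_iff_eq_zero.1 ((chainDensity_reachableTransition_le z).trans_eq hp)

theorem ae_joint_eq_iff_ae_joint_eq_posterior :
    (∀ᵐ z ∂Measure.pi fun _ : Fin T => μ,
      p.joint x T z = (∏ s ∈ Finset.range T, c s) * chainDensity (q.transition x) T z) ↔
      ∀ᵐ z ∂Measure.pi fun _ : Fin T => μ, (q.joint x z : ℝ≥0∞) = p.posterior x T z := by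
  refine Filter.eventually_congr (.of_forall fun z => ?_)
  rw [SequentialModel.posterior, h.evidence_eq le_rfl, ← ENNReal.coe_div (h.prod_ne_zero le_rfl),
    ENNReal.coe_inj, eq_div_iff (h.prod_ne_zero le_rfl), q.joint_eq_chainDensity, mul_comm, eq_comm]

theorem fivo_le (hN : 0 < N) (hC : ∀ t, MeasurableSet (C t)) :
    fivo C p x q ≤ ENNReal.log (p.evidence x T) := by
  have := isProbabilityMeasure_filterLaw (p := p) (q := q) (x := x) hC le_rfl
  have hmean := lintegral_estimate_le_evidence (p := p) (q := q) (x := x) hN hC le_rfl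
  rw [h.evidence_eq le_rfl] at hmean ⊢
  exact extendedExpectation_log_le measurable_fst (h.prod_ne_zero le_rfl) hmean

theorem fivo_eq_iff (hN : 0 < N) (hC : ∀ t, MeasurableSet (C t)) :
    fivo C p x q = ENNReal.log (p.evidence x T) ↔
      ∀ᵐ z ∂Measure.pi fun _ : Fin T => μ, (q.joint x z : ℝ≥0∞) = p.posterior x T z := by
  have := isProbabilityMeasure_filterLaw (p := p) (q := q) (x := x) hC le_rfl
  have hmean := lintegral_estimate_le_evidence (p := p) (q := q) (x := x) hN hC le_rfl
  rw [h.evidence_eq le_rfl] at hmean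
  rw [← h.ae_joint_eq_iff_ae_joint_eq_posterior, ← h.ae_estimate_eq_iff hN hC le_rfl,
    h.evidence_eq le_rfl, fivo,
    extendedExpectation_log_eq_iff measurable_fst (h.prod_ne_zero le_rfl) hmean]

end HasConstantPrediction

end ConstantPrediction

section Independence

variable {X Z : Type*} [MeasurableSpace X] [MeasurableSpace Z]
  {ν : Measure X} {μ : Measure Z} [SigmaFinite μ] {T t : ℕ} {p : SequentialModel ν μ T} {x : ℕ → X}

theorem SequentialModel.evidence_ne_zero_of_succ (ht : t < T) (h : p.evidence x (t + 1) ≠ 0) :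
    p.evidence x t ≠ 0 := by
  contrapose! h
  rw [SequentialModel.evidence,
    lintegral_eq_zero_iff (p.measurable_joint x ht.le).coe_nnreal_ennreal] at h
  rw [p.evidence_succ x ht, lintegral_congr_ae (g := 0) (h.mono fun z hz => ?_)]
  · exact lintegral_zero
  · exact mul_eq_zero_of_left hz _

/-- An infinite evidence would make the posterior, hence the lookahead posterior, vanish. -/
theorem SequentialModel.evidence_ne_top_of_succ (ht : t < T) (h0 : p.evidence x (t + 1) ≠ 0)
    (h1 : p.evidence x (t + 1) ≠ ∞)
    (hindep : ∀ᵐ z ∂Measure.pi fun _ : Fin t => μ,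
      p.lookaheadPosterior x t z = p.posterior x t z) : p.evidence x t ≠ ∞ := by
  contrapose! h0
  rw [p.evidence_succ x ht, lintegral_congr_ae (g := 0) (hindep.mono fun z hz => ?_)]
  · exact lintegral_zero
  · rw [SequentialModel.lookaheadPosterior, SequentialModel.posterior, h0, ENNReal.div_top,
      ENNReal.div_eq_zero_iff, p.lintegral_joint_concat x ht] at hz
    exact hz.resolve_right h1

theorem SequentialModel.evidence_ne_zero_and_ne_top (hpos : p.evidence x T ≠ 0)
    (hfin : p.evidence x T ≠ ∞)
    (hindep : ∀ t, 1 ≤ t → t < T → ∀ᵐ z ∂Measure.pi fun _ : Fin t => μ,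
      p.lookaheadPosterior x t z = p.posterior x t z) (ht : t ≤ T) :
    p.evidence x t ≠ 0 ∧ p.evidence x t ≠ ∞ := by
  induction ht using Nat.decreasingInduction with
  | self => exact ⟨hpos, hfin⟩
  | of_succ t ht ih =>
    refine ⟨SequentialModel.evidence_ne_zero_of_succ ht ih.1, ?_⟩
    rcases Nat.eq_zero_or_pos t with rfl | htpos
    · simp only [p.evidence_zero, ne_eq, ENNReal.one_ne_top, not_false_eq_true]
    · exact SequentialModel.evidence_ne_top_of_succ ht ih.1 ih.2 (hindep t htpos ht)

theorem SequentialModel.predictive_eq_evidence_div (ht : t < T) (h0 : p.evidence x (t + 1) ≠ 0)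
    (h1 : p.evidence x (t + 1) ≠ ∞)
    (hindep : 1 ≤ t → ∀ᵐ z ∂Measure.pi fun _ : Fin t => μ,
      p.lookaheadPosterior x t z = p.posterior x t z) :
    ∀ᵐ z ∂Measure.pi fun _ : Fin t => μ, p.joint x t z ≠ 0 →
      p.predictive x t z = p.evidence x (t + 1) / p.evidence x t := by
  rcases Nat.eq_zero_or_pos t with rfl | htpos
  · refine .of_forall fun z _ => ?_
    rw [p.evidence_zero, div_one, p.evidence_succ x ht, lintegral_pi_fin_zero,
      p.joint_eq_chainDensity, chainDensity_zero, ENNReal.coe_one, one_mul,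
      Subsingleton.elim z Fin.elim0]
  · filter_upwards [hindep htpos] with z hz hjoint
    rw [SequentialModel.lookaheadPosterior, SequentialModel.posterior,
      p.lintegral_joint_concat x ht, mul_div_assoc, div_eq_mul_inv (p.joint x t z : ℝ≥0∞),
      ENNReal.mul_right_inj (ENNReal.coe_ne_zero.2 hjoint) ENNReal.coe_ne_top] at hz
    rw [← ENNReal.div_mul_cancel h0 h1 (b := p.predictive x t z), hz, ENNReal.div_eq_inv_mul]

theorem SequentialModel.hasConstantPrediction (hpos : p.evidence x T ≠ 0)
    (hfin : p.evidence x T ≠ ∞)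
    (hindep : ∀ t, 1 ≤ t → t < T → ∀ᵐ z ∂Measure.pi fun _ : Fin t => μ,
      p.lookaheadPosterior x t z = p.posterior x t z) :
    HasConstantPrediction p x fun t => (p.evidence x (t + 1) / p.evidence x t).toNNReal := by
  have hevidence {t : ℕ} (ht : t ≤ T) :=
    SequentialModel.evidence_ne_zero_and_ne_top hpos hfin hindep ht
  have hratio (t : ℕ) (ht : t < T) : p.evidence x (t + 1) / p.evidence x t ≠ ∞ :=
    ENNReal.div_ne_top (hevidence ht).2 (hevidence ht.le).1
  refine ⟨fun t ht => ?_, fun t ht => ?_⟩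
  · exact (ENNReal.toNNReal_pos
      (ENNReal.div_ne_zero.2 ⟨(hevidence ht).1, (hevidence ht.le).2⟩) (hratio t ht)).ne'
  · rw [ENNReal.coe_toNNReal (hratio t ht)]
    exact SequentialModel.predictive_eq_evidence_div ht (hevidence ht).1 (hevidence ht).2
      fun h => hindep t h ht

end Independence

section Normalization

variable {A Z : Type*} [MeasurableSpace A] [MeasurableSpace Z]

theorem lintegral_div_eq_one {μ : Measure Z} {f : Z → ℝ≥0} (hf : Measurable f) {c : ℝ≥0}
    (hc : c ≠ 0) (h : ∫⁻ z, (f z : ℝ≥0∞) ∂μ = c) : ∫⁻ z, ((f z / c : ℝ≥0) : ℝ≥0∞) ∂μ = 1 := by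
  simp only [ENNReal.coe_div hc]
  simp only [div_eq_mul_inv]
  rw [lintegral_mul_const _ hf.coe_nnreal_ennreal, h,
    ENNReal.mul_inv_cancel (ENNReal.coe_ne_zero.2 hc) ENNReal.coe_ne_top]

variable (μ : Measure Z) [SigmaFinite μ] [NeZero μ]

theorem exists_measurable_lintegral_eq_one :
    ∃ ρ : Z → ℝ≥0, Measurable ρ ∧ ∫⁻ z, (ρ z : ℝ≥0∞) ∂μ = 1 := by
  obtain ⟨g, hgpos, hg, hglt⟩ := exists_pos_lintegral_lt_of_sigmaFinite μ one_ne_zero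
  have htop := (hglt.trans ENNReal.one_lt_top).ne
  have hne : ∫⁻ z, (g z : ℝ≥0∞) ∂μ ≠ 0 := fun h0 => by
    obtain ⟨z, hz⟩ := ((lintegral_eq_zero_iff hg.coe_nnreal_ennreal).1 h0).exists
    exact (hgpos z).ne' (ENNReal.coe_eq_zero.1 hz)
  exact ⟨_, hg.div_const _, lintegral_div_eq_one hg (ENNReal.toNNReal_pos hne htop).ne'
    (ENNReal.coe_toNNReal htop).symm⟩

theorem exists_measurable_normalization {f : A × Z → ℝ≥0} (hf : Measurable f) :
    ∃ g : A × Z → ℝ≥0, Measurable g ∧ (∀ a, ∫⁻ z, (g (a, z) : ℝ≥0∞) ∂μ = 1) ∧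
      ∀ a (c : ℝ≥0), c ≠ 0 → ∫⁻ z, (f (a, z) : ℝ≥0∞) ∂μ = c → ∀ z, f (a, z) = c * g (a, z) := by
  classical
  obtain ⟨ρ, hρ, hρone⟩ := exists_measurable_lintegral_eq_one μ
  set m : A → ℝ≥0 := fun a => (∫⁻ z, (f (a, z) : ℝ≥0∞) ∂μ).toNNReal with hm
  have hmeas : Measurable m := hf.coe_nnreal_ennreal.lintegral_prod_right'.ennreal_toNNReal
  refine ⟨fun a => if m a.1 = 0 then ρ a.2 else f a / m a.1, ?_, fun a => ?_, fun a c hc h z => ?_⟩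
  · exact Measurable.ite (hmeas.comp measurable_fst (measurableSet_singleton 0))
      (hρ.comp measurable_snd) (hf.div (hmeas.comp measurable_fst))
  · by_cases ha : m a = 0
    · simpa only [ha, if_true] using hρone
    · simp only [ha, if_false]
      refine lintegral_div_eq_one (hf.comp measurable_prodMk_left) ha (ENNReal.coe_toNNReal ?_).symm
      exact fun htop => ha (by rw [hm]; exact (ENNReal.toNNReal_eq_zero_iff _).2 (.inr htop))
  · have hmc : m a = c :=
      (congrArg ENNReal.toNNReal h).trans (ENNReal.toNNReal_coe c)
    simp only [hmc, hc, if_false, mul_div_cancel₀ _ hc]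

end Normalization

section Existence

variable {X Z : Type*} [MeasurableSpace X] [MeasurableSpace Z]
  {ν : Measure X} {μ : Measure Z} {T : ℕ}

theorem SequentialModel.neZero_latent (p : SequentialModel ν μ T) (hT : 0 < T) : NeZero μ := by
  refine ⟨fun hμ => ?_⟩
  have hone := p.lintegral_dens 0 hT Fin.elim0 Fin.elim0
  simp only [hμ, lintegral_zero_measure, lintegral_zero, zero_ne_one] at hone

variable [SigmaFinite μ]

theorem SequentialModel.exists_mem_matchSet (p : SequentialModel ν μ T) :
    ∃ q : Proposal X μ T, ∀ t < T, ∀ (x : ℕ → X) (zs : Fin t → Z) (c : ℝ≥0), c ≠ 0 →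
      p.predictive x t zs = c → zs ∈ matchSet p q x t c := by
  have hdens (t : ℕ) (ht : t < T) : Measurable fun a : ((Fin (t + 1) → X) × (Fin t → Z)) × Z =>
      p.dens t (fun i => a.1.1 i.castSucc) a.1.2 (a.1.1 (Fin.last t)) a.2 :=
    (p.measurable_dens t ht).comp (f := fun a : ((Fin (t + 1) → X) × (Fin t → Z)) × Z =>
      ((fun i : Fin t => a.1.1 i.castSucc), a.1.2, a.1.1 (Fin.last t), a.2)) (by fun_prop)
  choose g hg hgone hgmul using fun t (ht : t < T) =>
    have := p.neZero_latent (Nat.zero_lt_of_lt ht)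
    exists_measurable_normalization μ (hdens t ht)
  refine ⟨⟨fun t xs zs z => if ht : t < T then g t ht ((xs, zs), z) else 0, fun t ht => ?_,
    fun t ht xs zs => ?_⟩, fun t ht x zs c hc h => ?_⟩
  · simp only [ht, dif_pos]
    exact (hg t ht).comp (f := fun a : (Fin (t + 1) → X) × (Fin t → Z) × Z =>
      ((a.1, a.2.1), a.2.2)) (by fun_prop)
  · simpa only [ht, dif_pos] using hgone t ht (xs, zs)
  · refine Filter.Eventually.of_forall (f := ae μ) fun z => ?_
    simp only [Proposal.transition, ht, dif_pos]
    exact hgmul t ht (obs x (t + 1), zs) c hc h z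

theorem HasConstantPrediction.exists_ae_joint_eq_posterior {p : SequentialModel ν μ T} {x : ℕ → X}
    {c : ℕ → ℝ≥0} (h : HasConstantPrediction p x c) :
    ∃ q : Proposal X μ T,
      ∀ᵐ z ∂Measure.pi fun _ : Fin T => μ, (q.joint x z : ℝ≥0∞) = p.posterior x T z := by
  obtain ⟨q, hq⟩ := p.exists_mem_matchSet
  refine ⟨q, (h.ae_joint_eq_iff_ae_joint_eq_posterior).1 ?_⟩
  suffices hjoint : ∀ t ≤ T, ∀ᵐ z ∂Measure.pi fun _ : Fin t => μ,
      p.joint x t z = (∏ s ∈ Finset.range t, c s) * chainDensity (q.transition x) t z from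
    hjoint T le_rfl
  intro t ht
  induction t with
  | zero =>
    exact .of_forall fun z => by
      simp only [p.joint_eq_chainDensity, chainDensity_zero, Finset.prod_range_zero, mul_one]
  | succ t ih =>
    exact (h.ae_joint_succ_eq_iff ht).2 ⟨ih (Nat.le_of_succ_le ht),
      (h.predictive_eq t ht).mono fun z hz hjoint =>
        hq t ht x z (c t) (h.ne_zero t ht) (hz hjoint)⟩

end Existence

theorem proposition2_general {X Z : Type*} [MeasurableSpace X] [MeasurableSpace Z]
    (ν : Measure X) (μ : Measure Z) [SigmaFinite μ] (T N : ℕ) (hN : 0 < N)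
    (C : ℕ → Set (Fin N → ℝ≥0)) (hC : ∀ t, MeasurableSet (C t))
    (p : SequentialModel ν μ T) (x : ℕ → X)
    (hpos : 0 < p.evidence x T) (hfin : p.evidence x T < ∞)
    (hindep : ∀ t, 1 ≤ t → t < T → ∀ᵐ z ∂Measure.pi fun _ : Fin t => μ,
      p.lookaheadPosterior x t z = p.posterior x t z) :
    (fivoArgmax C p x).Nonempty ∧
      (∀ q : Proposal X μ T, q ∈ fivoArgmax C p x ↔
        ∀ᵐ z ∂Measure.pi fun _ : Fin T => μ, (q.joint x z : ℝ≥0∞) = p.posterior x T z) ∧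
      ∀ q ∈ fivoArgmax C p x, fivo C p x q = ENNReal.log (p.evidence x T) := by
  have h := SequentialModel.hasConstantPrediction hpos.ne' hfin.ne hindep
  obtain ⟨q₀, hq₀⟩ := h.exists_ae_joint_eq_posterior
  have hargmax (q : Proposal X μ T) :
      q ∈ fivoArgmax C p x ↔ fivo C p x q = ENNReal.log (p.evidence x T) :=
    ⟨fun hq => (h.fivo_le hN hC).antisymm (((h.fivo_eq_iff hN hC).2 hq₀).ge.trans (hq q₀)),
      fun hq q' => (h.fivo_le hN hC).trans_eq hq.symm⟩
  exact ⟨⟨q₀, (hargmax q₀).2 ((h.fivo_eq_iff hN hC).2 hq₀)⟩,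
    fun q => (hargmax q).trans (h.fivo_eq_iff hN hC), fun q => (hargmax q).1⟩

theorem proposition2 {X Z : Type*} [MeasurableSpace X] [MeasurableSpace Z]
    (ν : Measure X) (μ : Measure Z) [SigmaFinite ν] [SigmaFinite μ]
    (T N : ℕ) (hN : 0 < N)
    (C : ℕ → Set (Fin N → ℝ≥0)) (hC : ∀ t, MeasurableSet (C t))
    (p : SequentialModel ν μ T) (x : ℕ → X)
    (hpos : 0 < p.evidence x T) (hfin : p.evidence x T < ∞)
    (hindep : ∀ t, 1 ≤ t → t < T → ∀ᵐ z ∂Measure.pi fun _ : Fin t => μ,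
      p.lookaheadPosterior x t z = p.posterior x t z) :
    (fivoArgmax C p x).Nonempty ∧
      (∀ q : Proposal X μ T, q ∈ fivoArgmax C p x ↔
        ∀ᵐ z ∂Measure.pi fun _ : Fin T => μ, (q.joint x z : ℝ≥0∞) = p.posterior x T z) ∧
      ∀ q ∈ fivoArgmax C p x, fivo C p x q = ENNReal.log (p.evidence x T) :=
  proposition2_general ν μ T N hN C hC p x hpos hfin hindep
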